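/- Let $n\ge 1$. Identify $x\in\mathbb R^n$ with $(x,1)\in\mathbb R^{n+1}$; a vector $(y_1,\dots,y_{n+1})$ with $y_{n+1}>0$ is a set of projective coordinates of the point $(y_1/y_{n+1},\dots,y_n/y_{n+1})$. Let $V$ be the $(n+1)\times(n+1)$ matrix with $V_{ij}=1$ if $i=n+1$ or ($j\ge2$ and $i+j\le n+2$), and $V_{ij}=0$ otherwise; let $\Delta$ be the simplex whose vertices $v_1,\dots,v_{n+1}$ have as projective coordinates the columns of $V$. For $a\in\{0,1\}$ let $A_a$ be the $(n+1)\times(n+1)$ matrix whose nonzero entries, all equal to $1$, are in the positions $(a+1,1)$, $(1,n+1)$, $(2,n+1)$ and $(j+1,j)$ for $2\le j\le n$; let $B_a$ be the same matrix with the two $1$'s of the last column replaced by $1/2$. Let $\Delta_a=\Gamma_a$ be the simplex whose vertices are given by the columns of $VA_a$. Let $M_a:\Delta_a\to\Delta$ be the fractional-linear map given in projective coordinates by $VA_a^{-1}V^{-1}$, and $T_a:\Gamma_a\to\Delta$ the affine map given by $VB_a^{-1}V^{-1}$. Let $M,T:\Delta\to\Delta$ be the maps with $M=M_a$, $T=T_a$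 on $\Delta_a$ (the Mönkemeyer map and the tent map). Put $\Delta_\emptyset=\Gamma_\emptyset=\Delta$ for the empty word and, recursively, $\Delta_{a_0\dots a_{t-1}}=\Delta_{a_0}\cap M^{-1}\Delta_{a_1\dots a_{t-1}}$ and $\Gamma_{a_0\dots a_{t-1}}=\Gamma_{a_0}\cap T^{-1}\Gamma_{a_1\dots a_{t-1}}$. These are $n$-simplexes, with vertices given respectively by the columns of $VA_{a_0}\cdots A_{a_{t-1}}$ and of $VB_{a_0}\cdots B_{a_{t-1}}$. Let $\mathcal F_t$ (respectively $\mathcal B_t$) be the simplicial complex of all faces of the simplexes $\Delta_{a_0\dots a_{t-1}}$ (respectively $\Gamma_{a_0\dots a_{t-1}}$) with $a_0,\dots,a_{t-1}\in\{0,1\}$. For $\bar a=a_0a_1a_2\ldots\in\{0,1\}^{\mathbb N}$, each of the sets $\bigcap_{t\ge0}\Delta_{a_0\dots a_{t-1}}$ and $\bigcap_{t\ge0}\Gamma_{a_0\dots a_{t-1}}$ is a singleton; let $\varphi(\bar a)$ and $\upsilon(\bar a)$ be their respective elements. Then $\varphi$ maps $\{0,1\}^{\mathbb N}$ onto $\Delta$,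 and $\Phi:\Delta\to\Delta$ is well defined by $\Phi(\varphi(\bar a))=\upsilon(\bar a)$. Moreover the following hold. (1) Let $t\ge0$. There is a unique combinatorial isomorphism (inclusion-preserving bijection with inclusion-preserving inverse) $\mathcal F_t\to\mathcal B_t$ that fixes the vertices of $\Delta$, maps $\Delta_{a_0\dots a_{t-1}}$ to $\Gamma_{a_0\dots a_{t-1}}$ for all $a_0,\dots,a_{t-1}$, and maps the face of $\Delta_{a_0\dots a_{t-1}}$ spanned by any set of columns of $VA_{a_0}\cdots A_{a_{t-1}}$ to the face of $\Gamma_{a_0\dots a_{t-1}}$ spanned by the columns of $VB_{a_0}\cdots B_{a_{t-1}}$ with the same indices. If $\Xi\in\mathcal F_t$ and $\Lambda\in\mathcal B_t$ is the simplex corresponding to $\Xi$ under this isomorphism, then $\Phi$ restricts to a homeomorphism from $\Xi$ onto $\Lambda$. (2) For all $t\ge0$ and $a_0,\dots,a_{t-1}\in\{0,1\}$, the map $M_{a_{t-1}}\circ\cdots\circ M_{a_0}$ restricts to a homeomorphism from $\Delta_{a_0\dots a_{t-1}}$ onto $\Delta$, and on $\Delta$ $$\Phi=(T_{a_{t-1}}\circ\cdots\circ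 T_{a_0})\circ(\Phi\restriction\Delta_{a_0\dots a_{t-1}})\circ(M_{a_{t-1}}\circ\cdots\circ M_{a_0})^{-1}.$$ (3) For every $t\ge 0$ there is a homeomorphism $\Phi_t:\Delta\to\Delta$ such that, for all $a_0,\dots,a_{t-1}\in\{0,1\}$, if $w_1,\dots,w_{n+1}$ and $u_1,\dots,u_{n+1}$ are the vertices of $\Delta_{a_0\dots a_{t-1}}$ and of $\Gamma_{a_0\dots a_{t-1}}$ given by the columns of $VA_{a_0}\cdots A_{a_{t-1}}$ and of $VB_{a_0}\cdots B_{a_{t-1}}$, then $\Phi_t(\sum_i\alpha_iw_i)=\sum_i\alpha_iu_i$ for all $\alpha_i\ge0$ with $\sum_i\alpha_i=1$; and $\Phi_t\to\Phi$ uniformly on $\Delta$ as $t\to\infty$. -/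

import Mathlib

namespace Monkemeyer

noncomputable section

/-- The matrix `V`; indices start from `0`, so the nonzero entries, all equal to `1`, are those
in the last row and those in position `(i, j)` with `1 ≤ j` and `i + j ≤ n`. -/
def V (n : ℕ) : Matrix (Fin (n + 1)) (Fin (n + 1)) ℝ :=
  Matrix.of fun i j =>
    if i = Fin.last n ∨ (1 ≤ (j : ℕ) ∧ (i : ℕ) + (j : ℕ) ≤ n) then 1 else 0

/-- The common shape of `A_a` and `B_a`: the first column is the standard basis vector number `0`
(if `a = false`) or `1` (if `a = true`), the last column has the entry `c` in rows `0` and `1`,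
and each intermediate column `j` is the standard basis vector number `j + 1`. -/
def stepMatrix (n : ℕ) (c : ℝ) (a : Bool) : Matrix (Fin (n + 1)) (Fin (n + 1)) ℝ :=
  Matrix.of fun i j =>
    if (j : ℕ) = 0 then (if (i : ℕ) = (if a then 1 else 0) then 1 else 0)
    else if (j : ℕ) = n then (if (i : ℕ) ≤ 1 then c else 0)
    else (if (i : ℕ) = (j : ℕ) + 1 then 1 else 0)

/-- The matrix `A_a` (Farey side); `false` stands for `0` and `true` for `1`. -/
def A (n : ℕ) (a : Bool) : Matrix (Fin (n + 1)) (Fin (n + 1)) ℝ := stepMatrix n 1 a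

/-- The matrix `B_a` (barycentric side). -/
def B (n : ℕ) (a : Bool) : Matrix (Fin (n + 1)) (Fin (n + 1)) ℝ := stepMatrix n (1 / 2) a

/-- The point of `ℝⁿ` with the given projective coordinates. -/
def proj {n : ℕ} (y : Fin (n + 1) → ℝ) : Fin n → ℝ :=
  fun i => y i.castSucc / y (Fin.last n)

/-- The projective coordinates `(x₁, …, xₙ, 1)` of a point of `ℝⁿ`. -/
def lift {n : ℕ} (x : Fin n → ℝ) : Fin (n + 1) → ℝ :=
  Fin.snoc (α := fun _ => ℝ) x 1

/-- The point whose projective coordinates are the `j`-th column of a matrix. -/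
def colPoint {n : ℕ} (P : Matrix (Fin (n + 1)) (Fin (n + 1)) ℝ) (j : Fin (n + 1)) :
    Fin n → ℝ :=
  proj fun i => P i j

/-- The simplex `Δ`. -/
def Delta (n : ℕ) : Set (Fin n → ℝ) := convexHull ℝ (Set.range (colPoint (V n)))

/-- The simplexes `Δ_0`, `Δ_1`. -/
def Delta₁ (n : ℕ) (a : Bool) : Set (Fin n → ℝ) :=
  convexHull ℝ (Set.range (colPoint (V n * A n a)))

/-- The fractional-linear map `M_a`, given in projective coordinates by `V A_a⁻¹ V⁻¹`. -/
def Mbranch (n : ℕ) (a : Bool) (x : Fin n → ℝ) : Fin n → ℝ :=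
  proj ((V n * (A n a)⁻¹ * (V n)⁻¹).mulVec (lift x))

/-- The affine map `T_a`, given by `V B_a⁻¹ V⁻¹`, whose last row is `(0, …, 0, 1)`. -/
def Tbranch (n : ℕ) (a : Bool) (x : Fin n → ℝ) : Fin n → ℝ :=
  fun i => ((V n * (B n a)⁻¹ * (V n)⁻¹).mulVec (lift x)) i.castSucc

open Classical in
/-- The Mönkemeyer map. -/
def M (n : ℕ) (x : Fin n → ℝ) : Fin n → ℝ :=
  if x ∈ Delta₁ n false then Mbranch n false x else Mbranch n true x

open Classical in
/-- The tent map. -/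
def T (n : ℕ) (x : Fin n → ℝ) : Fin n → ℝ :=
  if x ∈ Delta₁ n false then Tbranch n false x else Tbranch n true x

/-- `Δ_{a₀…a_{t-1}}`, with `Δ` for the empty word. -/
def fareyCell (n : ℕ) : List Bool → Set (Fin n → ℝ)
  | [] => Delta n
  | a :: w => Delta₁ n a ∩ M n ⁻¹' fareyCell n w

/-- `Γ_{a₀…a_{t-1}}`, with `Δ` for the empty word. -/
def baryCell (n : ℕ) : List Bool → Set (Fin n → ℝ)
  | [] => Delta n
  | a :: w => Delta₁ n a ∩ T n ⁻¹' baryCell n w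

/-- The complex `𝓕_t`: all faces (the empty one included) of the simplexes `Δ_{a₀…a_{t-1}}`. -/
def fareyComplex (n t : ℕ) : Set (Set (Fin n → ℝ)) :=
  {σ | ∃ w : List Bool, w.length = t ∧
    ∃ s ⊆ (fareyCell n w).extremePoints ℝ, σ = convexHull ℝ s}

/-- The complex `𝓑_t`: all faces (the empty one included) of the simplexes `Γ_{a₀…a_{t-1}}`. -/
def baryComplex (n t : ℕ) : Set (Set (Fin n → ℝ)) :=
  {σ | ∃ w : List Bool, w.length = t ∧
    ∃ s ⊆ (baryCell n w).extremePoints ℝ, σ = convexHull ℝ s}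

/-- The `i`-th vertex of `Δ_{a₀…a_{t-1}}`: the `i`-th column of `V A_{a₀} ⋯ A_{a_{t-1}}`. -/
def fareyVertex (n : ℕ) (w : List Bool) (i : Fin (n + 1)) : Fin n → ℝ :=
  colPoint (V n * (w.map (A n)).prod) i

/-- The `i`-th vertex of `Γ_{a₀…a_{t-1}}`: the `i`-th column of `V B_{a₀} ⋯ B_{a_{t-1}}`. -/
def baryVertex (n : ℕ) (w : List Bool) (i : Fin (n + 1)) : Fin n → ℝ :=
  colPoint (V n * (w.map (B n)).prod) i

/-- `e` is the combinatorial isomorphism from `𝓕_t` to `𝓑_t`: it preserves and reflects the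
relation of being a face (it is an order isomorphism for inclusion), fixes the vertices of `Δ`,
sends `Δ_{a₀…a_{t-1}}` to `Γ_{a₀…a_{t-1}}`, and, on the faces of these simplexes, it is the
correspondence of the `i`-th vertex with the `i`-th vertex. -/
def IsCombIso (n t : ℕ) (e : fareyComplex n t ≃o baryComplex n t) : Prop :=
  (∀ j : Fin (n + 1), ∃ h : {colPoint (V n) j} ∈ fareyComplex n t,
    (e ⟨{colPoint (V n) j}, h⟩ : Set (Fin n → ℝ)) = {colPoint (V n) j}) ∧
  (∀ w : List Bool, w.length = t → ∃ h : fareyCell n w ∈ fareyComplex n t,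
    (e ⟨fareyCell n w, h⟩ : Set (Fin n → ℝ)) = baryCell n w) ∧
  (∀ w : List Bool, w.length = t → ∀ S : Set (Fin (n + 1)),
    ∃ h : convexHull ℝ (fareyVertex n w '' S) ∈ fareyComplex n t,
      (e ⟨convexHull ℝ (fareyVertex n w '' S), h⟩ : Set (Fin n → ℝ)) =
        convexHull ℝ (baryVertex n w '' S))

/-- The initial word `a₀…a_{t-1}` of a point of the Cantor space. -/
def initialWord (a : ℕ → Bool) (t : ℕ) : List Bool := (List.range t).map a

/-- `φ(a)`: the (unique) point of `⋂_t Δ_{a₀…a_{t-1}}`. -/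
def phi (n : ℕ) (a : ℕ → Bool) : Fin n → ℝ :=
  Classical.epsilon fun p => p ∈ ⋂ t, fareyCell n (initialWord a t)

/-- `υ(a)`: the (unique) point of `⋂_t Γ_{a₀…a_{t-1}}`. -/
def upsilon (n : ℕ) (a : ℕ → Bool) : Fin n → ℝ :=
  Classical.epsilon fun p => p ∈ ⋂ t, baryCell n (initialWord a t)

/-- The `n`-dimensional Minkowski function: `Φ(p) = υ(a)` for any `a` such that `φ(a) = p`.
Only its values on `Δ` are meaningful. -/
def Phi (n : ℕ) (p : Fin n → ℝ) : Fin n → ℝ :=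
  upsilon n (Classical.epsilon fun a : ℕ → Bool => phi n a = p)

/-- `M_{a_{t-1}} ∘ ⋯ ∘ M_{a₀}`. -/
def Mword (n : ℕ) : List Bool → (Fin n → ℝ) → (Fin n → ℝ)
  | [] => id
  | a :: w => Mword n w ∘ Mbranch n a

/-- `T_{a_{t-1}} ∘ ⋯ ∘ T_{a₀}`. -/
def Tword (n : ℕ) : List Bool → (Fin n → ℝ) → (Fin n → ℝ)
  | [] => id
  | a :: w => Tword n w ∘ Tbranch n a

/-- `f` restricts to a homeomorphism from `X` onto `Y`. -/
def RestrictsToHomeo {n : ℕ} (f : (Fin n → ℝ) → (Fin n → ℝ)) (X Y : Set (Fin n → ℝ)) : Prop :=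
  ∃ h : X ≃ₜ Y, ∀ x : X, (h x : Fin n → ℝ) = f x

/-- `f` is, on `Δ`, the piecewise-linear map `Φ_t`: it extends, by means of barycentric
coordinates on each `Δ_{a₀…a_{t-1}}`, the correspondence from the vertices of `𝓕_t` to the
vertices of `𝓑_t`. -/
def IsSimplicialExtension (n t : ℕ) (f : (Fin n → ℝ) → (Fin n → ℝ)) : Prop :=
  ∀ w : List Bool, w.length = t → ∀ α ∈ stdSimplex ℝ (Fin (n + 1)),
    f (∑ i, α i • fareyVertex n w i) = ∑ i, α i • baryVertex n w i

end

end Monkemeyer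

/-!
The simplexes `Δ_w` and `Γ_w` are treated together, as the values for `c = 1` and `c = 1 / 2` of a
family `cell n c w` depending on a parameter `c > 0`: in homogeneous barycentric coordinates with
respect to `Δ`, the cell of a word `w` is the image of the nonnegative cone under the product
`word n c w` of the step matrices. Since `M` and `T` undo one step matrix (`M_pt`, `T_pt`), the
recursive definitions of `fareyCell` and `baryCell` agree with this one.

*Combinatorics.* The two halves of a simplex meet in a common face, on which the two step matrices
agree (`stepMatrix_overlap`). By induction on the first letter, two cells of equal depth meet in a
common face, whose vertices are identified in the same way for all `c`; this is
`sum_smul_eq_of_word_mulVec_eq`. Hence the simplicial map from the subdivision for `c` to that for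
`c'` is well defined and injective, and taking images under it gives the combinatorial isomorphism.

*Convergence.* At each step the first two vertices are replaced by one of them and by their mediant,
which goes to the end of the queue. After a bounded number of steps any two vertices have a common
ancestor (`exists_common_row`). If the denominators of the starting vertices are within a factor
`2` of each other, the weights of the ancestors are bounded below, so the diameter is multiplied
by a fixed factor less than `1` (`diam_cell_append_le`). For `c = 1 / 2` all denominators are `1`.
For `c = 1` the denominators `d₀ ≤ d₁ ≤ ⋯ ≤ dₙ ≤ d₀ + d₁` stay ordered (`colSum_word_mono`), so that
the condition holds after each letter `1`; a word with finitely many `1`s reduces to the word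
`000…`, for which the cells shrink to a vertex by an explicit linear estimate
(`eq_of_isLimit_false`). Thus each infinite word determines one point, for both values of `c`.

*The map `Φ`.* By compactness two infinite words determine the same point if and only if their cells
meet at every depth, a condition that does not depend on `c` (`isLimit_transfer`). Therefore `Φ` is
well defined and injective, and it is continuous because `φ` is a quotient map from the Cantor
space. Self-similarity holds because putting a finite word in front of an infinite one acts on the
limit points by the matrix of the word. Finally, `Φ` preserves the faces of `Δ`, as the matrices for
`c = 1` and `c = 1 / 2` have the same zeros (`IsLimit.coord_eq_zero`), and by self-similarity it maps
every face of a cell onto the corresponding one.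
-/

namespace Monkemeyer

open Matrix Set Filter Topology

variable {n : ℕ}

/-! ### Homogeneous barycentric coordinates -/

/-- The point of `ℝⁿ` with homogeneous barycentric coordinates `y` with respect to the vertices
of `Δ`. It depends only on the ray of `y`, and is meaningful when `∑ i, y i ≠ 0`. -/
noncomputable def pt (y : Fin (n + 1) → ℝ) : Fin n → ℝ := proj (V n *ᵥ y)

theorem V_mulVec_last (y : Fin (n + 1) → ℝ) : (V n *ᵥ y) (Fin.last n) = ∑ i, y i := by
  simp [V, mulVec, dotProduct]

theorem lift_pt {y : Fin (n + 1) → ℝ} (hy : ∑ i, y i ≠ 0) :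
    lift (pt y) = (∑ i, y i)⁻¹ • (V n *ᵥ y) := by
  funext i
  refine Fin.lastCases ?_ (fun i => ?_) i
  · simp [lift, V_mulVec_last, hy]
  · simp only [lift, pt, proj, Fin.snoc_castSucc, V_mulVec_last, Pi.smul_apply, smul_eq_mul]
    ring

theorem V_mulVec_injective : Function.Injective (V n).mulVec := by
  rw [← Matrix.coe_mulVecLin, injective_iff_map_eq_zero]
  intro y hy
  have hrow (i : Fin (n + 1)) : ∑ j, V n i j * y j = 0 := congrFun hy i
  have hpos : ∀ k : ℕ, ∀ j : Fin (n + 1), 1 ≤ (j : ℕ) → (j : ℕ) ≤ k → y j = 0 := by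
    intro k
    induction k with
    | zero => intro j h1 h2; omega
    | succ k ih =>
      intro j h1 h2
      rcases Nat.lt_or_ge (j : ℕ) (k + 1) with h | h
      · exact ih j h1 (by omega)
      -- In row `n - j` the entries of positive index at most `j` are the nonzero ones.
      have hr := hrow ⟨n - j, by omega⟩
      rw [Finset.sum_eq_single j] at hr
      · simpa [V, h1, Fin.ext_iff, Nat.sub_add_cancel (Nat.lt_succ_iff.1 j.2)] using hr
      · intro l _ hl
        have hl' : (l : ℕ) ≠ j := fun h => hl (Fin.ext h)
        by_cases h3 : 1 ≤ (l : ℕ) ∧ (l : ℕ) ≤ k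
        · simp [ih l h3.1 h3.2]
        · have : V n ⟨n - j, by omega⟩ l = 0 := by
            simp only [V, of_apply, Fin.ext_iff, Fin.val_last]
            rw [if_neg]
            have := j.2
            omega
          simp [this]
      · simp
  have hlast := hrow (Fin.last n)
  rw [Finset.sum_eq_single 0] at hlast
  · funext j
    rcases Nat.eq_zero_or_pos (j : ℕ) with h | h
    · obtain rfl : j = 0 := Fin.ext h
      simpa [V] using hlast
    · exact hpos j j h le_rfl
  · intro j _ hj
    rw [hpos j j (Nat.pos_of_ne_zero fun h => hj (Fin.ext h)) le_rfl, mul_zero]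
  · simp

theorem isUnit_det_V : IsUnit (V n).det :=
  (Matrix.isUnit_iff_isUnit_det _).1 (Matrix.mulVec_injective_iff_isUnit.1 V_mulVec_injective)

theorem pt_smul {r : ℝ} (hr : r ≠ 0) (y : Fin (n + 1) → ℝ) : pt (r • y) = pt y := by
  funext i
  simp only [pt, proj, mulVec_smul, Pi.smul_apply, smul_eq_mul]
  exact mul_div_mul_left _ _ hr

/-- On the hyperplane `∑ i, y i = 1` the map `pt` is the restriction of a linear map. -/
theorem pt_of_sum_eq_one {y : Fin (n + 1) → ℝ} (hy : ∑ i, y i = 1) (k : Fin n) :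
    pt y k = (V n *ᵥ y) k.castSucc := by
  simp [pt, proj, V_mulVec_last, hy]

theorem eq_smul_of_pt_eq {y y' : Fin (n + 1) → ℝ} (hy : ∑ i, y i ≠ 0) (hy' : ∑ i, y' i ≠ 0)
    (h : pt y = pt y') : y = ((∑ i, y i) / ∑ i, y' i) • y' := by
  apply V_mulVec_injective
  have h1 : V n *ᵥ y = (∑ i, y i) • lift (pt y) := by rw [lift_pt hy, smul_inv_smul₀ hy]
  change V n *ᵥ y = V n *ᵥ _
  rw [h1, h, lift_pt hy', mulVec_smul, smul_smul, div_eq_mul_inv]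

/-- The cone of the homogeneous coordinates of the points of the face of `Δ` whose vertices
are indexed by `S`. -/
def cone (n : ℕ) (S : Set (Fin (n + 1))) : Set (Fin (n + 1) → ℝ) :=
  {y | (∀ i, 0 ≤ y i) ∧ 0 < ∑ i, y i ∧ ∀ i ∉ S, y i = 0}

theorem cone_mono {S S' : Set (Fin (n + 1))} (h : S ⊆ S') : cone n S ⊆ cone n S' :=
  fun _ hy => ⟨hy.1, hy.2.1, fun i hi => hy.2.2 i fun h' => hi (h h')⟩

theorem cone_subset_univ (S : Set (Fin (n + 1))) : cone n S ⊆ cone n univ :=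
  cone_mono (subset_univ S)

theorem mem_cone_univ {y : Fin (n + 1) → ℝ} :
    y ∈ cone n univ ↔ (∀ i, 0 ≤ y i) ∧ 0 < ∑ i, y i := by
  simp [cone]

theorem smul_mem_cone {S : Set (Fin (n + 1))} {y : Fin (n + 1) → ℝ} (hy : y ∈ cone n S) {r : ℝ}
    (hr : 0 < r) : r • y ∈ cone n S := by
  refine ⟨fun i => mul_nonneg hr.le (hy.1 i), ?_, fun i hi => by simp [hy.2.2 i hi]⟩
  simp only [Pi.smul_apply, smul_eq_mul, ← Finset.mul_sum]
  exact mul_pos hr hy.2.1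

theorem stdSimplex_subset_cone : stdSimplex ℝ (Fin (n + 1)) ⊆ cone n univ := fun y hy =>
  mem_cone_univ.2 ⟨hy.1, by rw [hy.2]; exact one_pos⟩

theorem single_mem_cone (i : Fin (n + 1)) : Pi.single i (1 : ℝ) ∈ cone n univ :=
  stdSimplex_subset_cone (single_mem_stdSimplex ℝ i)

/-- Points with equal image have proportional coordinates, with a positive factor. -/
theorem exists_pos_smul_of_pt_eq {y y' : Fin (n + 1) → ℝ} (hy : y ∈ cone n univ)
    (hy' : y' ∈ cone n univ) (h : pt y = pt y') : ∃ r : ℝ, 0 < r ∧ y = r • y' :=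
  ⟨_, div_pos hy.2.1 hy'.2.1, eq_smul_of_pt_eq hy.2.1.ne' hy'.2.1.ne' h⟩

/-- The convex hull of a finite family of points, as a set of convex combinations. -/
theorem convexHull_image_eq {ι E : Type*} [Fintype ι] [AddCommGroup E] [Module ℝ E] (v : ι → E)
    (S : Set ι) : convexHull ℝ (v '' S) =
      {x | ∃ α ∈ stdSimplex ℝ ι, (∀ i ∉ S, α i = 0) ∧ ∑ i, α i • v i = x} := by
  classical
  apply Subset.antisymm
  · refine convexHull_min ?_ ?_
    · rintro _ ⟨i, hi, rfl⟩
      refine ⟨Pi.single i 1, single_mem_stdSimplex ℝ i, fun j hj => ?_, ?_⟩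
      · exact Pi.single_eq_of_ne (by rintro rfl; exact hj hi) _
      · rw [Finset.sum_eq_single i] <;> simp +contextual
    · rintro _ ⟨α, hα, hα', rfl⟩ _ ⟨β, hβ, hβ', rfl⟩ a b ha hb hab
      refine ⟨a • α + b • β, convex_stdSimplex ℝ ι hα hβ ha hb hab, fun i hi => ?_, ?_⟩
      · simp [hα' i hi, hβ' i hi]
      · simp [add_smul, Finset.sum_add_distrib, Finset.smul_sum, mul_smul]
  · rintro _ ⟨α, hα, hα', rfl⟩
    have hsub : ∑ i with i ∈ S, α i • v i = ∑ i, α i • v i :=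
      Finset.sum_subset (Finset.subset_univ _) fun i _ hi => by
        rw [hα' i (by simpa using hi), zero_smul]
    have hsub' : ∑ i with i ∈ S, α i = 1 := by
      rw [← hα.2]
      exact Finset.sum_subset (Finset.subset_univ _) fun i _ hi => hα' i (by simpa using hi)
    rw [← hsub]
    refine (convex_convexHull ℝ (v '' S)).sum_mem (fun i _ => hα.1 i) hsub' fun i hi => ?_
    exact subset_convexHull ℝ _ (mem_image_of_mem v (by simpa using hi))

/-- The sum of the entries in a column: for `V * Q`, the last projective coordinate of the
vertex number `j`. -/
noncomputable def colSum (Q : Matrix (Fin (n + 1)) (Fin (n + 1)) ℝ) (j : Fin (n + 1)) : ℝ :=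
  ∑ i, Q i j

theorem sum_mulVec (Q : Matrix (Fin (n + 1)) (Fin (n + 1)) ℝ) (y : Fin (n + 1) → ℝ) :
    ∑ i, (Q *ᵥ y) i = ∑ j, colSum Q j * y j := by
  simp only [mulVec, dotProduct, colSum, Finset.sum_mul]
  exact Finset.sum_comm

theorem mulVec_nonneg {Q : Matrix (Fin (n + 1)) (Fin (n + 1)) ℝ} (hQ : ∀ i j, 0 ≤ Q i j)
    {y : Fin (n + 1) → ℝ} (hy : ∀ i, 0 ≤ y i) (i : Fin (n + 1)) : 0 ≤ (Q *ᵥ y) i := by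
  simp only [mulVec, dotProduct]
  exact Finset.sum_nonneg fun j _ => mul_nonneg (hQ i j) (hy j)

theorem mulVec_mem_cone {Q : Matrix (Fin (n + 1)) (Fin (n + 1)) ℝ} (hQ : ∀ i j, 0 ≤ Q i j)
    (hQ' : ∀ j, 0 < colSum Q j) {y : Fin (n + 1) → ℝ} (hy : y ∈ cone n univ) :
    Q *ᵥ y ∈ cone n univ := by
  refine mem_cone_univ.2 ⟨mulVec_nonneg hQ hy.1, ?_⟩
  rw [sum_mulVec]
  obtain ⟨j, -, hj⟩ := Finset.exists_lt_of_sum_lt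
    (show ∑ i : Fin (n + 1), (0 : ℝ) < ∑ i, y i by simpa using hy.2.1)
  exact Finset.sum_pos' (fun j _ => mul_nonneg (hQ' j).le (hy.1 j))
    ⟨j, Finset.mem_univ j, mul_pos (hQ' j) hj⟩

theorem colPoint_eq_pt (Q : Matrix (Fin (n + 1)) (Fin (n + 1)) ℝ) (j : Fin (n + 1)) :
    colPoint (V n * Q) j = pt (Q.col j) := rfl

theorem sum_mulVec_div_colSum {Q : Matrix (Fin (n + 1)) (Fin (n + 1)) ℝ}
    (hQ' : ∀ j, 0 < colSum Q j) (α : Fin (n + 1) → ℝ) :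
    ∑ i, (Q *ᵥ fun i => α i / colSum Q i) i = ∑ i, α i := by
  rw [sum_mulVec]
  exact Finset.sum_congr rfl fun i _ => mul_div_cancel₀ _ (hQ' i).ne'

/-- Convex combinations of the vertices, in homogeneous coordinates. -/
theorem sum_smul_colPoint {Q : Matrix (Fin (n + 1)) (Fin (n + 1)) ℝ} (hQ' : ∀ j, 0 < colSum Q j)
    {α : Fin (n + 1) → ℝ} (hα : ∑ i, α i = 1) :
    ∑ i, α i • colPoint (V n * Q) i = pt (Q *ᵥ fun i => α i / colSum Q i) := by
  have hsum := (sum_mulVec_div_colSum hQ' α).trans hα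
  funext k
  rw [pt_of_sum_eq_one hsum, mulVec_mulVec, Finset.sum_apply]
  refine Finset.sum_congr rfl fun i _ => ?_
  have : (V n * Q) (Fin.last n) i = colSum Q i := V_mulVec_last (Q.col i)
  simp only [Pi.smul_apply, smul_eq_mul, colPoint, proj, this]
  ring

theorem convexHull_colPoint {Q : Matrix (Fin (n + 1)) (Fin (n + 1)) ℝ}
    (hQ' : ∀ j, 0 < colSum Q j) (S : Set (Fin (n + 1))) :
    convexHull ℝ (colPoint (V n * Q) '' S) = (fun y => pt (Q *ᵥ y)) '' cone n S := by
  rw [convexHull_image_eq]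
  ext x
  constructor
  · rintro ⟨α, hα, hαS, rfl⟩
    refine ⟨fun i => α i / colSum Q i, ⟨fun i => div_nonneg (hα.1 i) (hQ' i).le, ?_, ?_⟩, ?_⟩
    · obtain ⟨j, -, hj⟩ := Finset.exists_lt_of_sum_lt
        (show ∑ i : Fin (n + 1), (0 : ℝ) < ∑ i, α i by simp [hα.2])
      exact Finset.sum_pos' (fun i _ => div_nonneg (hα.1 i) (hQ' i).le)
        ⟨j, Finset.mem_univ j, div_pos hj (hQ' j)⟩
    · intro i hi
      simp [hαS i hi]
    · exact (sum_smul_colPoint hQ' hα.2).symm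
  · rintro ⟨y, hy, rfl⟩
    have hs : 0 < ∑ i, colSum Q i * y i := by
      obtain ⟨j, -, hj⟩ := Finset.exists_lt_of_sum_lt
        (show ∑ i : Fin (n + 1), (0 : ℝ) < ∑ i, y i by simpa using hy.2.1)
      exact Finset.sum_pos' (fun j _ => mul_nonneg (hQ' j).le (hy.1 j))
        ⟨j, Finset.mem_univ j, mul_pos (hQ' j) hj⟩
    have h1 : ∑ i, colSum Q i * y i / ∑ i, colSum Q i * y i = 1 := by
      rw [← Finset.sum_div, div_self hs.ne']
    refine ⟨fun i => colSum Q i * y i / ∑ i, colSum Q i * y i, ⟨fun i =>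
      div_nonneg (mul_nonneg (hQ' i).le (hy.1 i)) hs.le, h1⟩, fun i hi => by simp [hy.2.2 i hi], ?_⟩
    rw [sum_smul_colPoint hQ' h1]
    change _ = pt (Q *ᵥ y)
    rw [← pt_smul (inv_ne_zero hs.ne') (Q *ᵥ y), ← mulVec_smul]
    congr 2
    funext i
    have := (hQ' i).ne'
    simp only [Pi.smul_apply, smul_eq_mul]
    field_simp

/-- Two convex combinations of vertices that give the same point do so already in normalized
homogeneous coordinates: the coordinates of both have sum `1`. -/
theorem mulVec_div_colSum_eq {Q R : Matrix (Fin (n + 1)) (Fin (n + 1)) ℝ}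
    (hQ : ∀ j, 0 < colSum Q j) (hR : ∀ j, 0 < colSum R j) {α β : Fin (n + 1) → ℝ}
    (hα : ∑ i, α i = 1) (hβ : ∑ i, β i = 1)
    (h : ∑ i, α i • colPoint (V n * Q) i = ∑ i, β i • colPoint (V n * R) i) :
    (Q *ᵥ fun i => α i / colSum Q i) = R *ᵥ fun i => β i / colSum R i := by
  have hsQ := (sum_mulVec_div_colSum hQ α).trans hα
  have hsR := (sum_mulVec_div_colSum hR β).trans hβ
  rw [sum_smul_colPoint hQ hα, sum_smul_colPoint hR hβ] at h
  have h1 := eq_smul_of_pt_eq (by simp [hsQ]) (by simp [hsR]) h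
  rwa [hsQ, hsR, div_one, one_smul] at h1

theorem colPoint_combination_injective {Q : Matrix (Fin (n + 1)) (Fin (n + 1)) ℝ}
    (hQ' : ∀ j, 0 < colSum Q j) (hinj : Function.Injective Q.mulVec) {α β : Fin (n + 1) → ℝ}
    (hα : ∑ i, α i = 1) (hβ : ∑ i, β i = 1)
    (h : ∑ i, α i • colPoint (V n * Q) i = ∑ i, β i • colPoint (V n * Q) i) : α = β := by
  have h1 := mulVec_div_colSum_eq hQ' hQ' hα hβ h
  funext i
  have h2 : α i / colSum Q i = β i / colSum Q i := congrFun (hinj h1) i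
  have := (hQ' i).ne'
  field_simp at h2
  exact h2

theorem colPoint_mem_extremePoints {Q : Matrix (Fin (n + 1)) (Fin (n + 1)) ℝ}
    (hQ' : ∀ j, 0 < colSum Q j) (hinj : Function.Injective Q.mulVec) (i : Fin (n + 1)) :
    colPoint (V n * Q) i ∈ (convexHull ℝ (range (colPoint (V n * Q)))).extremePoints ℝ := by
  rw [mem_extremePoints_iff_left]
  refine ⟨subset_convexHull ℝ _ (mem_range_self i), ?_⟩
  rw [← image_univ, convexHull_image_eq]
  rintro _ ⟨α, hα, -, rfl⟩ _ ⟨β, hβ, -, rfl⟩ ⟨a, b, ha, hb, hab, h⟩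
  have h1 : a • α + b • β = Pi.single i 1 := by
    refine colPoint_combination_injective hQ' hinj
      (convex_stdSimplex ℝ _ hα hβ ha.le hb.le hab).2 (single_mem_stdSimplex ℝ i).2 ?_
    have h2 : ∑ j, (Pi.single i (1 : ℝ) : Fin (n + 1) → ℝ) j • colPoint (V n * Q) j =
        colPoint (V n * Q) i := by
      rw [Finset.sum_eq_single i] <;> simp +contextual
    rw [h2, ← h]
    simp [add_smul, Finset.sum_add_distrib, Finset.smul_sum, mul_smul]
  have h0 (j : Fin (n + 1)) (hj : j ≠ i) : α j = 0 := by
    have h2 : a * α j + b * β j = 0 := by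
      simpa [hj] using congrFun h1 j
    have h3 := mul_nonneg hb.le (hβ.1 j)
    have h4 := mul_nonneg ha.le (hα.1 j)
    exact (mul_eq_zero.1 (by linarith : a * α j = 0)).resolve_left ha.ne'
  have h5 : α i = 1 := by
    rw [← hα.2]
    exact (Finset.sum_eq_single i (fun j _ hj => h0 j hj) (by simp)).symm
  rw [Finset.sum_eq_single i (fun j _ hj => by rw [h0 j hj, zero_smul]) (by simp), h5, one_smul]

/-! ### The step matrices -/

theorem val_one_fin [NeZero n] : ((1 : Fin (n + 1)) : ℕ) = 1 := by
  obtain ⟨m, rfl⟩ := Nat.exists_eq_succ_of_ne_zero (NeZero.ne n)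
  rfl

theorem stepMatrix_mulVec [NeZero n] (c : ℝ) (a : Bool) (z : Fin (n + 1) → ℝ)
    (i : Fin (n + 1)) : (stepMatrix n c a *ᵥ z) i =
      if (i : ℕ) = 0 then (if a then 0 else z 0) + c * z (Fin.last n)
      else if (i : ℕ) = 1 then (if a then z 0 else 0) + c * z (Fin.last n)
      else z ⟨i - 1, by omega⟩ := by
  obtain ⟨m, rfl⟩ := Nat.exists_eq_succ_of_ne_zero (NeZero.ne n)
  simp only [mulVec, dotProduct, stepMatrix, of_apply]
  rw [Fin.sum_univ_succ, Fin.sum_univ_castSucc]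
  have hmid : ∑ k : Fin m, (if ((k.castSucc.succ : Fin (m + 2)) : ℕ) = 0 then
        (if (i : ℕ) = (if a then 1 else 0) then (1 : ℝ) else 0)
      else if ((k.castSucc.succ : Fin (m + 2)) : ℕ) = m + 1 then (if (i : ℕ) ≤ 1 then c else 0)
      else (if (i : ℕ) = ((k.castSucc.succ : Fin (m + 2)) : ℕ) + 1 then 1 else 0)) *
        z k.castSucc.succ = if 2 ≤ (i : ℕ) then z ⟨i - 1, by omega⟩ else 0 := by
    by_cases hi : 2 ≤ (i : ℕ)
    · rw [if_pos hi, Finset.sum_eq_single ⟨i - 2, by omega⟩]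
      · have h1 : ((i : ℕ) - 2 + 1) ≠ m + 1 := by omega
        have h2 : (i : ℕ) = (i : ℕ) - 2 + 1 + 1 := by omega
        have h3 : (Fin.castSucc ⟨i - 2, by omega⟩ : Fin (m + 1)).succ = ⟨i - 1, by omega⟩ :=
          Fin.ext (by simp; omega)
        simp only [h3]
        rw [if_neg (by omega), if_neg (by omega), if_pos (by omega), one_mul]
      · intro k _ hk
        have h2 : (i : ℕ) ≠ k + 1 + 1 := fun h => hk (Fin.ext (by simp; omega))
        have h1 : (k : ℕ) ≠ m := by omega
        simp [h1, h2]
      · simp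
    · rw [if_neg hi]
      refine Finset.sum_eq_zero fun k _ => ?_
      have h1 : (k : ℕ) ≠ m := by omega
      have h2 : (i : ℕ) ≠ k + 1 + 1 := by omega
      simp [h1, h2]
  simp only [Nat.succ_eq_add_one] at hmid ⊢
  rw [hmid]
  rcases Nat.lt_or_ge (i : ℕ) 2 with hi | hi
  · rcases (by omega : (i : ℕ) = 0 ∨ (i : ℕ) = 1) with h | h <;> cases a <;> simp [h]
  · have h0 : (i : ℕ) ≠ 0 := by omega
    have h1 : (i : ℕ) ≠ 1 := by omega
    have h2 : ¬ (i : ℕ) ≤ 1 := by omega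
    cases a <;> simp [h0, h1, h2, hi]

theorem vecMul_stepMatrix [NeZero n] (c : ℝ) (a : Bool) (y : Fin (n + 1) → ℝ)
    (j : Fin (n + 1)) : (y ᵥ* stepMatrix n c a) j =
      if (j : ℕ) = 0 then (if a then y 1 else y 0)
      else if h : (j : ℕ) = n then c * (y 0 + y 1)
      else y ⟨j + 1, by omega⟩ := by
  have h1 := val_one_fin (n := n)
  simp only [vecMul, dotProduct, stepMatrix, of_apply]
  split_ifs with h2 h3 h3
  · rw [Finset.sum_eq_single 1]
    · simp only [h1]
      simp
    · intro i _ hi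
      have : (i : ℕ) ≠ 1 := fun h => hi (Fin.ext (by rw [h, h1]))
      simp [this]
    · simp
  · rw [Finset.sum_eq_single 0]
    · simp
    · intro i _ hi
      have : (i : ℕ) ≠ 0 := fun h => hi (Fin.ext (by rw [h]; rfl))
      simp [this]
    · simp
  · have h01 : (0 : Fin (n + 1)) ≠ 1 := fun h => by
      have := congrArg Fin.val h
      rw [h1] at this
      exact absurd this (by simp)
    rw [Finset.sum_eq_add_of_mem 0 1 (by simp) (by simp) h01]
    · simp only [h1, Fin.val_zero, zero_le_one, le_refl, if_true]
      ring
    · intro i _ hi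
      have e0 : (i : ℕ) ≠ 0 := fun h => hi.1 (Fin.ext (by rw [h]; rfl))
      have e1 : (i : ℕ) ≠ 1 := fun h => hi.2 (Fin.ext (by rw [h, h1]))
      have : ¬ (i : ℕ) ≤ 1 := by omega
      simp [this]
  · rw [Finset.sum_eq_single ⟨j + 1, by omega⟩]
    · simp
    · intro i _ hi
      have : (i : ℕ) ≠ j + 1 := fun h => hi (Fin.ext h)
      simp [this]
    · simp

theorem stepMatrix_nonneg {c : ℝ} (hc : 0 ≤ c) (a : Bool) (i j : Fin (n + 1)) :
    0 ≤ stepMatrix n c a i j := by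
  simp only [stepMatrix, of_apply]
  split_ifs <;> first | exact hc | exact zero_le_one | exact le_rfl

theorem stepMatrix_mulVec_zero [NeZero n] (c : ℝ) (a : Bool) (z : Fin (n + 1) → ℝ) :
    (stepMatrix n c a *ᵥ z) 0 = (if a then 0 else z 0) + c * z (Fin.last n) := by
  simp [stepMatrix_mulVec]

theorem stepMatrix_mulVec_one [NeZero n] (c : ℝ) (a : Bool) (z : Fin (n + 1) → ℝ) :
    (stepMatrix n c a *ᵥ z) 1 = (if a then z 0 else 0) + c * z (Fin.last n) := by
  rw [stepMatrix_mulVec, if_neg, if_pos val_one_fin]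
  rw [val_one_fin]
  exact one_ne_zero

theorem stepMatrix_mulVec_succ [NeZero n] (c : ℝ) (a : Bool) (z : Fin (n + 1) → ℝ)
    {j : ℕ} (hj : 1 ≤ j) (hjn : j < n) :
    (stepMatrix n c a *ᵥ z) ⟨j + 1, by omega⟩ = z ⟨j, by omega⟩ := by
  rw [stepMatrix_mulVec, if_neg, if_neg]
  · rfl
  · simp; omega
  · simp

/-- The intermediate coordinates of a vector can be read off its image under a step matrix, whatever
the letter. -/
theorem eq_of_stepMatrix_mulVec [NeZero n] {c : ℝ} {a b : Bool}
    {z z' : Fin (n + 1) → ℝ} (h : stepMatrix n c a *ᵥ z = stepMatrix n c b *ᵥ z')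
    (h0 : z 0 = z' 0) (hl : z (Fin.last n) = z' (Fin.last n)) : z = z' := by
  funext j
  rcases Nat.eq_zero_or_pos (j : ℕ) with hj | hj
  · obtain rfl : j = 0 := Fin.ext hj
    exact h0
  rcases Nat.lt_or_ge (j : ℕ) n with hjn | hjn
  · have := congrFun h ⟨j + 1, by omega⟩
    rwa [stepMatrix_mulVec_succ c a z hj hjn, stepMatrix_mulVec_succ c b z' hj hjn] at this
  · obtain rfl : j = Fin.last n := Fin.ext (by simp; omega)
    exact hl

theorem stepMatrix_mulVec_injective [NeZero n] {c : ℝ} (hc : 0 < c) (a : Bool) :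
    Function.Injective (stepMatrix n c a).mulVec := by
  intro z z' h
  have e0 := congrFun h 0
  have e1 := congrFun h 1
  simp only [stepMatrix_mulVec_zero, stepMatrix_mulVec_one] at e0 e1
  have hl : z (Fin.last n) = z' (Fin.last n) := by
    apply mul_left_cancel₀ hc.ne'
    cases a <;> simp only [Bool.false_eq_true, if_false, if_true] at e0 e1 <;> linarith
  rw [hl] at e0 e1
  refine eq_of_stepMatrix_mulVec h ?_ hl
  cases a <;> simp only [Bool.false_eq_true, if_false, if_true] at e0 e1 <;> linarith

/-- The two halves of `Δ` meet in their common face, on which the coordinates agree. -/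
theorem stepMatrix_overlap [NeZero n] {c : ℝ} (hc : 0 < c) {a b : Bool} (hab : a ≠ b)
    {z z' : Fin (n + 1) → ℝ} (hz : 0 ≤ z 0) (hz' : 0 ≤ z' 0)
    (h : stepMatrix n c a *ᵥ z = stepMatrix n c b *ᵥ z') : z = z' ∧ z 0 = 0 := by
  have e0 := congrFun h 0
  have e1 := congrFun h 1
  simp only [stepMatrix_mulVec_zero, stepMatrix_mulVec_one] at e0 e1
  have h0 : z 0 = 0 ∧ z' 0 = 0 := by
    cases a <;> cases b <;> first
      | exact absurd rfl hab
      | simp only [Bool.false_eq_true, if_false, if_true] at e0 e1; constructor <;> linarith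
  have hl : z (Fin.last n) = z' (Fin.last n) := by
    apply mul_left_cancel₀ hc.ne'
    cases a <;> cases b <;> first
      | exact absurd rfl hab
      | simp only [Bool.false_eq_true, if_false, if_true] at e0 e1; linarith
  exact ⟨eq_of_stepMatrix_mulVec h (h0.1.trans h0.2.symm) hl, h0.1⟩

/-- The two halves cover `Δ`. -/
theorem exists_stepMatrix_mulVec [NeZero n] {c : ℝ} (hc : 0 < c) {y : Fin (n + 1) → ℝ}
    (hy : y ∈ cone n univ) : ∃ a : Bool, ∃ z ∈ cone n univ, stepMatrix n c a *ᵥ z = y := by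
  obtain ⟨a, ha⟩ : ∃ a : Bool, (if a then y 0 else y 1) ≤ (if a then y 1 else y 0) := by
    rcases le_total (y 0) (y 1) with h | h
    · exact ⟨true, by simpa using h⟩
    · exact ⟨false, by simpa using h⟩
  -- The larger of the first two coordinates exceeds the other by the new coordinate `0`, and the
  -- smaller one, divided by `c`, is the new last coordinate.
  let z : Fin (n + 1) → ℝ := fun j =>
    if (j : ℕ) = 0 then (if a then y 1 else y 0) - (if a then y 0 else y 1)
    else if h : (j : ℕ) = n then (if a then y 0 else y 1) / c
    else y ⟨j + 1, by omega⟩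
  have hz0 : z 0 = (if a then y 1 else y 0) - (if a then y 0 else y 1) := by simp [z]
  have hzl : z (Fin.last n) = (if a then y 0 else y 1) / c := by
    simp [z, NeZero.ne n]
  have hzy : stepMatrix n c a *ᵥ z = y := by
    funext i
    rw [stepMatrix_mulVec, hz0, hzl, mul_div_cancel₀ _ hc.ne']
    split_ifs with h1 h2 h2
    · obtain rfl : i = 0 := Fin.ext h1
      simp
    · obtain rfl : i = 0 := Fin.ext h1
      simp
    · obtain rfl : i = 1 := Fin.ext (by rw [h2, val_one_fin])
      simp
    · obtain rfl : i = 1 := Fin.ext (by rw [h2, val_one_fin])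
      simp
    · simp only [z]
      rw [if_neg (by omega), dif_neg (by omega)]
      congr 1
      exact Fin.ext (by simp; omega)
  have hz : ∀ j, 0 ≤ z j := by
    intro j
    simp only [z]
    split_ifs <;> first
      | exact hy.1 _
      | exact div_nonneg (hy.1 _) hc.le
      | simp_all
  refine ⟨a, z, mem_cone_univ.2 ⟨hz, ?_⟩, hzy⟩
  refine lt_of_le_of_ne (Finset.sum_nonneg fun i _ => hz i) fun h => ?_
  have h0 : z = 0 := by
    funext i
    exact (Finset.sum_eq_zero_iff_of_nonneg fun i _ => hz i).1 h.symm i (Finset.mem_univ i)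
  have := hy.2.1
  rw [← hzy, h0] at this
  simp at this

/-! ### Products of step matrices and their cells -/

/-- The product of the step matrices along a word; `c = 1` is the Farey side, `c = 1 / 2` the
barycentric one. -/
noncomputable def word (n : ℕ) (c : ℝ) (w : List Bool) : Matrix (Fin (n + 1)) (Fin (n + 1)) ℝ :=
  (w.map (stepMatrix n c)).prod

@[simp] theorem word_nil (c : ℝ) : word n c [] = 1 := rfl

@[simp] theorem word_cons (c : ℝ) (a : Bool) (w : List Bool) :
    word n c (a :: w) = stepMatrix n c a * word n c w := by simp [word]

theorem word_append (c : ℝ) (w w' : List Bool) :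
    word n c (w ++ w') = word n c w * word n c w' := by simp [word]

@[simp] theorem word_singleton (c : ℝ) (a : Bool) : word n c [a] = stepMatrix n c a := by
  simp [word]

theorem word_nonneg {c : ℝ} (hc : 0 ≤ c) (w : List Bool) (i j : Fin (n + 1)) :
    0 ≤ word n c w i j := by
  induction w generalizing i with
  | nil => simp only [word_nil, one_apply]; split_ifs <;> simp
  | cons a w ih =>
    rw [word_cons, mul_apply]
    exact Finset.sum_nonneg fun k _ => mul_nonneg (stepMatrix_nonneg hc a i k) (ih k)

theorem colSum_eq_vecMul (Q : Matrix (Fin (n + 1)) (Fin (n + 1)) ℝ) (j : Fin (n + 1)) :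
    colSum Q j = ((fun _ => 1) ᵥ* Q) j := by
  simp [colSum, vecMul, dotProduct]

theorem colSum_mul (Q R : Matrix (Fin (n + 1)) (Fin (n + 1)) ℝ) :
    colSum (Q * R) = colSum Q ᵥ* R := by
  funext j
  have h : colSum Q = (fun _ => 1) ᵥ* Q := funext (colSum_eq_vecMul Q)
  rw [colSum_eq_vecMul, h, vecMul_vecMul]

theorem colSum_stepMatrix [NeZero n] (c : ℝ) (a : Bool) (j : Fin (n + 1)) :
    colSum (stepMatrix n c a) j = if (j : ℕ) = n then 2 * c else 1 := by
  rw [colSum_eq_vecMul, vecMul_stepMatrix]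
  have := NeZero.ne n
  split_ifs <;> first | rfl | omega | ring

theorem colSum_stepMatrix_pos [NeZero n] {c : ℝ} (hc : 0 < c) (a : Bool) (j : Fin (n + 1)) :
    0 < colSum (stepMatrix n c a) j := by
  rw [colSum_stepMatrix]
  split_ifs <;> positivity

theorem word_mulVec_mem_cone [NeZero n] {c : ℝ} (hc : 0 < c) (w : List Bool)
    {y : Fin (n + 1) → ℝ} (hy : y ∈ cone n univ) : word n c w *ᵥ y ∈ cone n univ := by
  induction w with
  | nil => simpa using hy
  | cons a w ih =>
    rw [word_cons, ← mulVec_mulVec]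
    exact mulVec_mem_cone (stepMatrix_nonneg hc.le a) (colSum_stepMatrix_pos hc a) ih

theorem colSum_word_pos [NeZero n] {c : ℝ} (hc : 0 < c) (w : List Bool) (j : Fin (n + 1)) :
    0 < colSum (word n c w) j := by
  have := (word_mulVec_mem_cone hc w (single_mem_cone j)).2.1
  simpa [colSum] using this

theorem word_mulVec_injective [NeZero n] {c : ℝ} (hc : 0 < c) (w : List Bool) :
    Function.Injective (word n c w).mulVec := by
  induction w with
  | nil => intro y y' h; simpa using h
  | cons a w ih =>
    intro y y' h
    simp only [word_cons, ← mulVec_mulVec] at h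
    exact ih (stepMatrix_mulVec_injective hc a h)

/-- The positions of the zeros do not depend on the parameter. -/
theorem word_eq_zero_iff {c c' : ℝ} (hc : 0 < c) (hc' : 0 < c') (w : List Bool)
    (i j : Fin (n + 1)) : word n c w i j = 0 ↔ word n c' w i j = 0 := by
  induction w generalizing i with
  | nil => simp
  | cons a w ih =>
    have hstep (k : Fin (n + 1)) : stepMatrix n c a i k = 0 ↔ stepMatrix n c' a i k = 0 := by
      simp only [stepMatrix, of_apply]
      split_ifs <;> simp [hc.ne', hc'.ne']
    simp only [word_cons, mul_apply]
    rw [Finset.sum_eq_zero_iff_of_nonneg fun k _ =>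
        mul_nonneg (stepMatrix_nonneg hc.le a i k) (word_nonneg hc.le w k j),
      Finset.sum_eq_zero_iff_of_nonneg fun k _ =>
        mul_nonneg (stepMatrix_nonneg hc'.le a i k) (word_nonneg hc'.le w k j)]
    simp only [mul_eq_zero, hstep, ih]

/-- The simplex whose vertices are the columns of `V` times the product along a word, described by
homogeneous coordinates. -/
def cell (n : ℕ) (c : ℝ) (w : List Bool) : Set (Fin n → ℝ) :=
  (fun y => pt (word n c w *ᵥ y)) '' cone n univ

theorem convexHull_range_word [NeZero n] {c : ℝ} (hc : 0 < c) (w : List Bool) :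
    convexHull ℝ (range (colPoint (V n * word n c w))) = cell n c w := by
  rw [← image_univ, convexHull_colPoint (colSum_word_pos hc w)]
  rfl

theorem Delta_eq_cell [NeZero n] {c : ℝ} (hc : 0 < c) : Delta n = cell n c [] := by
  rw [← convexHull_range_word hc]
  simp [Delta]

theorem mem_Delta_iff [NeZero n] {x : Fin n → ℝ} : x ∈ Delta n ↔ ∃ y ∈ cone n univ, pt y = x := by
  rw [Delta_eq_cell one_pos]
  simp [cell]

/-- The parameter `c` affects the projective coordinates of the last vertex only by a factor. -/
theorem Delta₁_eq_cell [NeZero n] {c : ℝ} (hc : 0 < c) (a : Bool) :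
    Delta₁ n a = cell n c [a] := by
  rw [← convexHull_range_word hc, Delta₁]
  congr 2
  funext j
  rw [word_singleton, colPoint_eq_pt, colPoint_eq_pt, A]
  have : (stepMatrix n c a).col j =
      (if (j : ℕ) = n then c else 1) • (stepMatrix n 1 a).col j := by
    have := NeZero.ne n
    funext i
    simp only [col_apply, stepMatrix, of_apply, Pi.smul_apply, smul_eq_mul]
    split_ifs <;> first | omega | simp
  rw [this, pt_smul]
  split_ifs
  exacts [hc.ne', one_ne_zero]

/-- In projective coordinates, `V S⁻¹ V⁻¹` takes the point of coordinates `S y` to that of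
coordinates `y`. -/
theorem conj_mulVec_lift_pt {S : Matrix (Fin (n + 1)) (Fin (n + 1)) ℝ}
    (hS : Function.Injective S.mulVec) {y : Fin (n + 1) → ℝ} (hy : ∑ i, (S *ᵥ y) i ≠ 0) :
    (V n * S⁻¹ * (V n)⁻¹) *ᵥ lift (pt (S *ᵥ y)) = V n *ᵥ ((∑ i, (S *ᵥ y) i)⁻¹ • y) := by
  have hS' : IsUnit S.det :=
    (Matrix.isUnit_iff_isUnit_det _).1 (Matrix.mulVec_injective_iff_isUnit.1 hS)
  rw [lift_pt hy, mulVec_smul, mulVec_smul, mulVec_mulVec, mulVec_mulVec,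
    nonsing_inv_mul_cancel_right _ _ isUnit_det_V, nonsing_inv_mul_cancel_right _ _ hS']

theorem Mbranch_pt [NeZero n] (a : Bool) {y : Fin (n + 1) → ℝ} (hy : y ∈ cone n univ) :
    Mbranch n a (pt (stepMatrix n 1 a *ᵥ y)) = pt y := by
  have h := (mulVec_mem_cone (stepMatrix_nonneg zero_le_one a)
    (colSum_stepMatrix_pos one_pos a) hy).2.1.ne'
  rw [Mbranch, A, conj_mulVec_lift_pt (stepMatrix_mulVec_injective one_pos a) h]
  exact pt_smul (inv_ne_zero h) y

theorem sum_stepMatrix_half_mulVec [NeZero n] (a : Bool) (y : Fin (n + 1) → ℝ) :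
    ∑ i, (stepMatrix n (1 / 2) a *ᵥ y) i = ∑ i, y i := by
  rw [sum_mulVec]
  exact Finset.sum_congr rfl fun j _ => by rw [colSum_stepMatrix]; simp

theorem Tbranch_pt [NeZero n] (a : Bool) {y : Fin (n + 1) → ℝ} (hy : y ∈ cone n univ) :
    Tbranch n a (pt (stepMatrix n (1 / 2) a *ᵥ y)) = pt y := by
  have h := hy.2.1.ne'
  funext i
  rw [Tbranch, B, conj_mulVec_lift_pt (stepMatrix_mulVec_injective (by norm_num) a)
    (by rwa [sum_stepMatrix_half_mulVec]), sum_stepMatrix_half_mulVec,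
    ← pt_of_sum_eq_one, pt_smul (inv_ne_zero h)]
  simp only [Pi.smul_apply, smul_eq_mul, ← Finset.mul_sum]
  exact inv_mul_cancel₀ h

open Classical in
/-- On the common face of the two halves of `Δ` the two branches agree, so that the choice made
there by a piecewise definition is immaterial. -/
theorem piecewise_pt [NeZero n] {c : ℝ} (hc : 0 < c) {G : Bool → (Fin n → ℝ) → (Fin n → ℝ)}
    (hG : ∀ a, ∀ y ∈ cone n univ, G a (pt (stepMatrix n c a *ᵥ y)) = pt y) (a : Bool)
    {y : Fin (n + 1) → ℝ} (hy : y ∈ cone n univ) :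
    (if pt (stepMatrix n c a *ᵥ y) ∈ Delta₁ n false then G false (pt (stepMatrix n c a *ᵥ y))
      else G true (pt (stepMatrix n c a *ᵥ y))) = pt y := by
  cases a with
  | false =>
    rw [if_pos, hG false y hy]
    rw [Delta₁_eq_cell hc]
    exact ⟨y, hy, by simp⟩
  | true =>
    split_ifs with h
    · rw [Delta₁_eq_cell hc] at h
      obtain ⟨z, hz, h⟩ := h
      simp only [word_singleton] at h
      obtain ⟨r, hr, h'⟩ := exists_pos_smul_of_pt_eq
        (mulVec_mem_cone (stepMatrix_nonneg hc.le _) (colSum_stepMatrix_pos hc _) hz)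
        (mulVec_mem_cone (stepMatrix_nonneg hc.le _) (colSum_stepMatrix_pos hc _) hy) h
      rw [← mulVec_smul] at h'
      have hzy := (stepMatrix_overlap hc (by simp) (hz.1 0) ((smul_mem_cone hy hr).1 0) h').1
      rw [← h, hG false z hz, hzy, pt_smul hr.ne']
    · exact hG true y hy

theorem M_pt [NeZero n] (a : Bool) {y : Fin (n + 1) → ℝ} (hy : y ∈ cone n univ) :
    M n (pt (stepMatrix n 1 a *ᵥ y)) = pt y :=
  piecewise_pt one_pos (fun a _ hy => Mbranch_pt a hy) a hy

theorem T_pt [NeZero n] (a : Bool) {y : Fin (n + 1) → ℝ} (hy : y ∈ cone n univ) :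
    T n (pt (stepMatrix n (1 / 2) a *ᵥ y)) = pt y :=
  piecewise_pt (by norm_num) (fun a _ hy => Tbranch_pt a hy) a hy

theorem cell_cons [NeZero n] {c : ℝ} (hc : 0 < c) {F : (Fin n → ℝ) → (Fin n → ℝ)}
    (hF : ∀ a, ∀ y ∈ cone n univ, F (pt (stepMatrix n c a *ᵥ y)) = pt y) (a : Bool)
    (w : List Bool) : cell n c (a :: w) = Delta₁ n a ∩ F ⁻¹' cell n c w := by
  rw [Delta₁_eq_cell hc]
  apply Subset.antisymm
  · rintro _ ⟨y, hy, rfl⟩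
    have hy' := word_mulVec_mem_cone hc w hy
    simp only [word_cons, ← mulVec_mulVec]
    refine ⟨⟨_, hy', by simp⟩, ⟨y, hy, ?_⟩⟩
    rw [hF a _ hy']
  · rintro _ ⟨⟨z, hz, rfl⟩, h⟩
    simp only [word_singleton, mem_preimage, hF a z hz] at h ⊢
    obtain ⟨y, hy, h⟩ := h
    obtain ⟨r, hr, h'⟩ := exists_pos_smul_of_pt_eq hz (word_mulVec_mem_cone hc w hy) h.symm
    refine ⟨r • y, smul_mem_cone hy hr, ?_⟩
    simp only [word_cons, ← mulVec_mulVec, mulVec_smul, h']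

theorem fareyCell_eq_cell [NeZero n] (w : List Bool) : fareyCell n w = cell n 1 w := by
  induction w with
  | nil => exact Delta_eq_cell one_pos
  | cons a w ih => rw [fareyCell, ih, cell_cons one_pos fun a _ hy => M_pt a hy]

theorem baryCell_eq_cell [NeZero n] (w : List Bool) : baryCell n w = cell n (1 / 2) w := by
  induction w with
  | nil => exact Delta_eq_cell (by norm_num)
  | cons a w ih => rw [baryCell, ih, cell_cons (by norm_num) fun a _ hy => T_pt a hy]

theorem cell_append_subset [NeZero n] {c : ℝ} (hc : 0 < c) (w w' : List Bool) :
    cell n c (w ++ w') ⊆ cell n c w := by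
  rintro _ ⟨y, hy, rfl⟩
  exact ⟨_, word_mulVec_mem_cone hc w' hy, by simp [word_append]⟩

theorem cell_subset_Delta [NeZero n] {c : ℝ} (hc : 0 < c) (w : List Bool) :
    cell n c w ⊆ Delta n := by
  rw [Delta_eq_cell hc]
  exact cell_append_subset hc [] w

theorem isCompact_cell [NeZero n] {c : ℝ} (hc : 0 < c) (w : List Bool) :
    IsCompact (cell n c w) := by
  rw [← convexHull_range_word hc]
  exact (finite_range _).isCompact_convexHull ℝ

theorem cell_nonempty (c : ℝ) (w : List Bool) : (cell n c w).Nonempty :=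
  ⟨_, _, single_mem_cone 0, rfl⟩

/-- Two words of equal length: whenever the simplexes of the two words share a point for the
parameter `c`, they do so along faces whose vertices are the same points with the same weights,
and for every other parameter `c'` these vertices are the same as well. The equality of weights
is stated by testing against an arbitrary function `F` of pairs of columns. -/
theorem sum_smul_eq_of_word_mulVec_eq [NeZero n] {c c' : ℝ} (hc : 0 < c) (hc' : 0 < c')
    {E : Type*} [AddCommGroup E] [Module ℝ E] :
    ∀ (w w' : List Bool), w.length = w'.length → ∀ y y' : Fin (n + 1) → ℝ, (∀ i, 0 ≤ y i) →
      (∀ i, 0 ≤ y' i) → word n c w *ᵥ y = word n c w' *ᵥ y' →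
      ∀ F : (Fin (n + 1) → ℝ) → (Fin (n + 1) → ℝ) → E,
        ∑ i, y i • F ((word n c w).col i) ((word n c' w).col i) =
          ∑ i, y' i • F ((word n c w').col i) ((word n c' w').col i) := by
  intro w
  induction w with
  | nil =>
    intro w' hw y y' _ _ h F
    obtain rfl : w' = [] := List.length_eq_zero_iff.1 hw.symm
    simp only [word_nil, one_mulVec] at h
    rw [h]
  | cons a w ih =>
    rintro (_ | ⟨b, w'⟩) hw y y' hy hy' h F
    · simp at hw
    have hw' : w.length = w'.length := by simpa using hw
    simp only [word_cons, ← mulVec_mulVec] at h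
    have hcol (e : ℝ) (d : Bool) (u : List Bool) (i : Fin (n + 1)) :
        (word n e (d :: u)).col i = stepMatrix n e d *ᵥ (word n e u).col i := by
      rw [word_cons]; rfl
    simp only [hcol]
    by_cases hab : a = b
    · subst hab
      exact ih w' hw' y y' hy hy' (stepMatrix_mulVec_injective hc a h)
        fun u v => F (stepMatrix n c a *ᵥ u) (stepMatrix n c' a *ᵥ v)
    · obtain ⟨h1, h2⟩ := stepMatrix_overlap hc hab
        (mulVec_nonneg (word_nonneg hc.le w) hy 0) (mulVec_nonneg (word_nonneg hc.le w') hy' 0) h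
      have h3 : (word n c w' *ᵥ y') 0 = 0 := by rw [← h1, h2]
      rw [ih w' hw' y y' hy hy' h1
        fun u v => F (stepMatrix n c a *ᵥ u) (stepMatrix n c' a *ᵥ v)]
      refine Finset.sum_congr rfl fun i _ => ?_
      rcases eq_or_ne (y' i) 0 with hi | hi
      · simp [hi]
      -- A vertex of positive weight lies on the common face of the two halves.
      have h4 : word n c w' 0 i = 0 := by
        simp only [mulVec, dotProduct] at h3
        have h5 := (Finset.sum_eq_zero_iff_of_nonneg fun k _ =>
          mul_nonneg (word_nonneg hc.le w' 0 k) (hy' k)).1 h3 i (Finset.mem_univ i)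
        exact (mul_eq_zero.1 h5).resolve_right hi
      have h6 : word n c' w' 0 i = 0 := (word_eq_zero_iff hc hc' w' 0 i).1 h4
      have hface (e : ℝ) (u : Fin (n + 1) → ℝ) (hu : u 0 = 0) :
          stepMatrix n e a *ᵥ u = stepMatrix n e b *ᵥ u := by
        funext k
        rw [stepMatrix_mulVec, stepMatrix_mulVec]
        simp [hu]
      rw [hface c _ h4, hface c' _ h6]

/-! ### Long words have pairwise overlapping columns -/

open Classical in
/-- The columns of the step matrix whose nonzero entries lie in the rows in `X`. -/
noncomputable def next (n : ℕ) (a : Bool) (X : Finset (Fin (n + 1))) : Finset (Fin (n + 1)) :=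
  Finset.univ.filter fun j => ∀ i, stepMatrix n 1 a i j ≠ 0 → i ∈ X

/-- The columns of the product along a word whose nonzero entries lie in the rows in `X`. -/
noncomputable def run (n : ℕ) : Finset (Fin (n + 1)) → List Bool → Finset (Fin (n + 1))
  | X, [] => X
  | X, a :: u => run n (next n a X) u

theorem mem_run {X : Finset (Fin (n + 1))} {u : List Bool} {j : Fin (n + 1)} :
    j ∈ run n X u ↔ ∀ i, word n 1 u i j ≠ 0 → i ∈ X := by
  induction u generalizing X with
  | nil => simp [run, one_apply]
  | cons a u ih =>
    rw [run, ih]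
    have h (i : Fin (n + 1)) : word n 1 (a :: u) i j ≠ 0 ↔
        ∃ k, stepMatrix n 1 a i k ≠ 0 ∧ word n 1 u k j ≠ 0 := by
      rw [word_cons, mul_apply, ne_eq, Finset.sum_eq_zero_iff_of_nonneg fun k _ =>
        mul_nonneg (stepMatrix_nonneg zero_le_one a i k) (word_nonneg zero_le_one u k j)]
      simp
    simp only [h, next, Finset.mem_filter, Finset.mem_univ, true_and]
    constructor
    · rintro H i ⟨k, h1, h2⟩
      exact H k h2 i h1
    · intro H k h2 i h1
      exact H i ⟨k, h1, h2⟩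

theorem run_append (X : Finset (Fin (n + 1))) (u v : List Bool) :
    run n X (u ++ v) = run n (run n X u) v := by
  induction u generalizing X with
  | nil => rfl
  | cons a u ih => exact ih _

theorem zero_mem_next [NeZero n] {a : Bool} {X : Finset (Fin (n + 1))} :
    0 ∈ next n a X ↔ (if a then 1 else 0) ∈ X := by
  simp only [next, Finset.mem_filter, Finset.mem_univ, true_and]
  have h1 := val_one_fin (n := n)
  constructor
  · intro h
    apply h
    cases a
    · simp [stepMatrix]
    · simp only [stepMatrix, of_apply, if_true, h1]
      simp
  · intro h i hi
    have : i = if a then 1 else 0 := by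
      by_contra hne
      apply hi
      simp only [stepMatrix, of_apply, Fin.val_zero, if_true]
      rw [if_neg]
      intro h2
      apply hne
      apply Fin.ext
      rw [h2]
      cases a
      · rfl
      · simp only [if_true, h1]
    rwa [this]

theorem last_mem_next [NeZero n] {a : Bool} {X : Finset (Fin (n + 1))} :
    Fin.last n ∈ next n a X ↔ 0 ∈ X ∧ 1 ∈ X := by
  simp only [next, Finset.mem_filter, Finset.mem_univ, true_and]
  have h1 := val_one_fin (n := n)
  have hn := NeZero.ne n
  have hS (i : Fin (n + 1)) : stepMatrix n 1 a i (Fin.last n) ≠ 0 ↔ (i : ℕ) ≤ 1 := by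
    simp [stepMatrix, hn]
  simp only [hS]
  constructor
  · intro h
    exact ⟨h 0 (by simp), h 1 h1.le⟩
  · rintro ⟨h2, h3⟩ i hi
    rcases (by omega : (i : ℕ) = 0 ∨ (i : ℕ) = 1) with h | h
    · rwa [show i = 0 from Fin.ext h]
    · rwa [show i = 1 from Fin.ext (h.trans h1.symm)]

theorem mem_next_of_lt {a : Bool} {X : Finset (Fin (n + 1))} {j : ℕ} (hj : 1 ≤ j) (hjn : j < n) :
    (⟨j, by omega⟩ : Fin (n + 1)) ∈ next n a X ↔ (⟨j + 1, by omega⟩ : Fin (n + 1)) ∈ X := by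
  simp only [next, Finset.mem_filter, Finset.mem_univ, true_and]
  have hS (i : Fin (n + 1)) : stepMatrix n 1 a i ⟨j, by omega⟩ ≠ 0 ↔ i = ⟨j + 1, by omega⟩ := by
    have hval : stepMatrix n 1 a i ⟨j, by omega⟩ = if (i : ℕ) = j + 1 then 1 else 0 := by
      simp only [stepMatrix, of_apply]
      rw [if_neg (by omega), if_neg hjn.ne]
    rw [hval]
    constructor
    · intro h
      by_contra hne
      exact h (if_neg fun h' => hne (Fin.ext h'))
    · rintro rfl
      simp
  simp [hS]

/-- The columns in `next n a X` are at most as many as the rows in `X`; they are fewer if the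
row `0` is in `X` but the column `0` is not in `next n a X`. -/
theorem card_next_le [NeZero n] (a : Bool) (X : Finset (Fin (n + 1))) :
    (next n a X).card ≤ X.card ∧
      (0 ∈ X → (next n a X).card = X.card → 0 ∈ next n a X) := by
  have h1 := val_one_fin (n := n)
  have hn := NeZero.ne n
  -- The intermediate columns go to the row of their nonzero entry, the outer ones to the two
  -- rows `0` and `1`.
  let f : Fin (n + 1) → Fin (n + 1) := fun j =>
    if (j : ℕ) = 0 then (if a then 1 else 0)
    else if h : (j : ℕ) = n then (if a then 0 else 1)
    else ⟨j + 1, by omega⟩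
  have hfv (j : Fin (n + 1)) : ((f j : Fin (n + 1)) : ℕ) =
      if (j : ℕ) = 0 then (if a then 1 else 0) else if (j : ℕ) = n then (if a then 0 else 1)
      else (j : ℕ) + 1 := by
    simp only [f]
    split_ifs <;> first | exact h1 | rfl
  have hinj : Function.Injective f := by
    intro j k h
    have h2 := congrArg Fin.val h
    rw [hfv, hfv] at h2
    apply Fin.ext
    cases a <;> simp only [Bool.false_eq_true, if_false, if_true] at h2 <;>
      split_ifs at h2 <;> omega
  have hmap (j : Fin (n + 1)) (hj : j ∈ next n a X) : f j ∈ X := by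
    by_cases hj0 : (j : ℕ) = 0
    · obtain rfl : j = 0 := Fin.ext hj0
      simpa [f] using zero_mem_next.1 hj
    by_cases hjn : (j : ℕ) = n
    · obtain rfl : j = Fin.last n := Fin.ext hjn
      have := last_mem_next.1 hj
      simp only [f, Fin.val_last, hn, if_false, dif_pos]
      cases a
      · simpa using this.2
      · simpa using this.1
    · have h2 : j = ⟨(j : ℕ), by omega⟩ := rfl
      rw [h2, mem_next_of_lt (by omega) (by omega)] at hj
      simpa only [f, hj0, hjn, if_false, dif_neg, not_false_eq_true] using hj
  refine ⟨Finset.card_le_card_of_injOn f hmap hinj.injOn, fun h0 hcard => ?_⟩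
  by_contra hnot
  have hlt : (next n a X).card ≤ (X.erase 0).card := by
    refine Finset.card_le_card_of_injOn f (fun j hj => Finset.mem_erase.2 ⟨?_, hmap j hj⟩)
      hinj.injOn
    intro hf
    have h2 := hfv j
    rw [hf] at h2
    have hja : a = true := by
      by_contra ha
      exact hnot (zero_mem_next.2 (by simpa [ha] using h0))
    subst hja
    simp only [if_true, Fin.val_zero] at h2
    split_ifs at h2 with h3 h4
    · obtain rfl : j = Fin.last n := Fin.ext h4
      exact hnot (zero_mem_next.2 (by simpa using (last_mem_next.1 hj).2))
  rw [Finset.card_erase_of_mem h0, hcard] at hlt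
  have := Finset.card_pos.2 ⟨0, h0⟩
  omega

theorem card_run_le [NeZero n] (X : Finset (Fin (n + 1))) (u : List Bool) :
    (run n X u).card ≤ X.card := by
  induction u generalizing X with
  | nil => rfl
  | cons a u ih => exact (ih _).trans (card_next_le a X).1

/-- As long as no element is lost, the index `0` does not leave the set. -/
theorem zero_mem_run [NeZero n] {X : Finset (Fin (n + 1))} {u : List Bool} (h0 : 0 ∈ X)
    (h : (run n X u).card = X.card) : 0 ∈ run n X u := by
  induction u generalizing X with
  | nil => exact h0
  | cons a u ih =>
    have h1 : (next n a X).card = X.card :=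
      le_antisymm (card_next_le a X).1 (h.symm.le.trans (card_run_le (next n a X) u))
    exact ih ((card_next_le a X).2 h0 h1) (by rw [h1]; exact h)

/-- If the index `0` always stays outside the set, no new column enters it: the elements move towards
the front of the queue, and there they are lost. -/
theorem run_eq_empty_of_zero_notMem [NeZero n] (u : List Bool) (X : Finset (Fin (n + 1))) (k : ℕ)
    (hk : ∀ j ∈ X, (j : ℕ) ≤ k) (hku : k ≤ u.length)
    (h : ∀ v, v <+: u → 0 ∉ run n X v) : run n X u = ∅ := by
  induction u generalizing X k with
  | nil =>
    refine Finset.eq_empty_of_forall_notMem fun j hj => h [] List.prefix_rfl ?_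
    have := hk j hj
    have hj0 : j = 0 := Fin.ext (by
      have hk0 : k ≤ 0 := hku
      rw [Fin.val_zero]
      omega)
    rwa [hj0] at hj
  | cons a u ih =>
    refine ih (next n a X) (k - 1) (fun j hj => ?_) (by simp at hku; omega)
      fun v hv => h (a :: v) (List.cons_prefix_cons.2 ⟨rfl, hv⟩)
    by_cases hj0 : (j : ℕ) = 0
    · omega
    by_cases hjn : (j : ℕ) = n
    · obtain rfl : j = Fin.last n := Fin.ext hjn
      exact absurd (last_mem_next.1 hj).1 (h [] List.nil_prefix)
    · have h2 : j = ⟨(j : ℕ), by omega⟩ := rfl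
      rw [h2, mem_next_of_lt (by omega) (by omega)] at hj
      have := hk _ hj
      simp at this
      omega

theorem disjoint_run [NeZero n] {X Y : Finset (Fin (n + 1))} (h : Disjoint X Y) (u : List Bool) :
    Disjoint (run n X u) (run n Y u) := by
  rw [Finset.disjoint_left]
  intro j hX hY
  rw [mem_run] at hX hY
  have hpos : 0 < ∑ i, word n 1 u i j := colSum_word_pos one_pos u j
  obtain ⟨i, -, hi⟩ := Finset.exists_ne_zero_of_sum_ne_zero hpos.ne'
  exact Finset.disjoint_left.1 h (hX i hi) (hY i hi)

/-- If both counts were constant and positive along `2 * n` steps, then either the column `0`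
never belongs to the two sets during the first `n` steps, and both become empty; or from some
moment on it belongs to the same set, and the other set becomes empty in `n` steps. -/
theorem run_block [NeZero n] {X Y : Finset (Fin (n + 1))} (h : Disjoint X Y) {u : List Bool}
    (hu : u.length = 2 * n) : run n X u = ∅ ∨ run n Y u = ∅ ∨
      (run n X u).card + (run n Y u).card + 1 ≤ X.card + Y.card := by
  by_contra! hcon
  obtain ⟨hX, hY, hcard⟩ := hcon
  have hcX := card_run_le X u
  have hcY := card_run_le Y u
  have key : ∀ X Y : Finset (Fin (n + 1)), Disjoint X Y → (run n X u).card = X.card →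
      (run n Y u).Nonempty → ∀ v, v <+: u → v.length ≤ n → 0 ∉ run n X v := by
    rintro X Y hd hc hne v ⟨v', rfl⟩ hv h0
    rw [run_append] at hc hne
    have hv' : n ≤ v'.length := by simp at hu; omega
    refine hne.ne_empty (run_eq_empty_of_zero_notMem v' (run n Y v) n (fun j _ => by omega) hv' ?_)
    rintro v₁ ⟨v₂, rfl⟩ h1
    have h2 : (run n (run n X v) v₁).card = (run n X v).card := by
      apply le_antisymm (card_run_le _ _)
      rw [run_append] at hc
      have := card_run_le (run n (run n X v) v₁) v₂
      have := card_run_le X v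
      omega
    exact Finset.disjoint_left.1 (disjoint_run (disjoint_run hd v) v₁) (zero_mem_run h0 h2) h1
  have hsplit : run n X u = run n (run n X (u.take n)) (u.drop n) := by
    rw [← run_append, List.take_append_drop]
  have hlen : (u.take n).length = n := by simp; omega
  have hemp : run n X (u.take n) = ∅ := by
    refine run_eq_empty_of_zero_notMem _ X n (fun j _ => by omega) hlen.ge fun v hv => ?_
    exact key X Y h (by omega) hY v (hv.trans (List.take_prefix n u)) (hv.length_le.trans hlen.le)
  have := card_run_le (run n X (u.take n)) (u.drop n)
  rw [← hsplit, hemp] at this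
  exact hX.ne_empty (Finset.card_eq_zero.1 (by simpa using this))

/-- Each block of `2 * n` steps either empties one of the two sets or costs an element. -/
theorem run_blocks [NeZero n] (k : ℕ) {X Y : Finset (Fin (n + 1))} (h : Disjoint X Y)
    {u : List Bool} (hu : u.length = k * (2 * n)) : run n X u = ∅ ∨ run n Y u = ∅ ∨
      (run n X u).card + (run n Y u).card + k ≤ X.card + Y.card := by
  induction k generalizing X Y u with
  | zero =>
    have := card_run_le X u
    have := card_run_le Y u
    exact Or.inr (Or.inr (by omega))
  | succ k ih =>
    have hle : 2 * n ≤ u.length := by rw [hu]; nlinarith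
    have hX (Z : Finset (Fin (n + 1))) :
        run n Z u = run n (run n Z (u.take (2 * n))) (u.drop (2 * n)) := by
      rw [← run_append, List.take_append_drop]
    have hempty : run n ∅ (u.drop (2 * n)) = ∅ :=
      Finset.card_eq_zero.1 (by simpa using card_run_le ∅ (u.drop (2 * n)))
    have h1 := run_block h (u := u.take (2 * n)) (by simp; omega)
    have h2 := ih (disjoint_run h (u.take (2 * n))) (u := u.drop (2 * n))
      (by rw [List.length_drop, hu, Nat.succ_mul]; omega)
    rw [hX X, hX Y]
    rcases h1 with h1 | h1 | h1
    · rw [h1, hempty]; exact Or.inl rfl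
    · rw [h1, hempty]; exact Or.inr (Or.inl rfl)
    · rcases h2 with h2 | h2 | h2
      · exact Or.inl h2
      · exact Or.inr (Or.inl h2)
      · exact Or.inr (Or.inr (by omega))

/-- A number of steps after which any two vertices are combinations of vertices of the starting
simplex that have one of these in common. -/
def scramblingTime (n : ℕ) : ℕ := (n + 2) * (2 * n)

theorem exists_common_row [NeZero n] {c : ℝ} (hc : 0 < c) {w : List Bool}
    (hw : w.length = scramblingTime n) (j k : Fin (n + 1)) :
    ∃ i, word n c w i j ≠ 0 ∧ word n c w i k ≠ 0 := by
  classical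
  simp only [ne_eq, word_eq_zero_iff hc one_pos]
  by_contra! hcon
  let X (l : Fin (n + 1)) : Finset (Fin (n + 1)) := Finset.univ.filter fun i => word n 1 w i l ≠ 0
  have hmem (l : Fin (n + 1)) : l ∈ run n (X l) w := mem_run.2 fun i hi => by simpa [X] using hi
  have hd : Disjoint (X j) (X k) := by
    rw [Finset.disjoint_left]
    intro i hj hk
    simp only [X, Finset.mem_filter, Finset.mem_univ, true_and] at hj hk
    exact hk (hcon i hj)
  rcases run_blocks (n + 2) hd hw with h | h | h
  · simpa [h] using hmem j
  · simpa [h] using hmem k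
  · have h2 := Finset.card_le_univ (X j ∪ X k)
    rw [Finset.card_union_of_disjoint hd, Fintype.card_fin] at h2
    omega

/-! ### Contraction of the cells -/

/-- Two convex combinations of the points `v i` that share a point `v l` with weight at least `ε`
in both are closer than any bound for the mutual distances of the `v i`. -/
theorem dist_combination_le {ι E : Type*} [Fintype ι] [SeminormedAddCommGroup E]
    [NormedSpace ℝ E] {v : ι → E} {D ε : ℝ} (hD : ∀ i j, dist (v i) (v j) ≤ D) {α β : ι → ℝ}
    (hα : α ∈ stdSimplex ℝ ι) (hβ : β ∈ stdSimplex ℝ ι) {l : ι} (hε : 0 ≤ ε) (hαl : ε ≤ α l)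
    (hβl : ε ≤ β l) : dist (∑ i, α i • v i) (∑ i, β i • v i) ≤ (1 - ε ^ 2) * D := by
  classical
  have hD0 : 0 ≤ D := dist_nonneg.trans (hD l l)
  have h1 : ∑ i, α i • v i - ∑ i, β i • v i = ∑ i, ∑ j, (α i * β j) • (v i - v j) := by
    simp only [smul_sub, Finset.sum_sub_distrib, mul_smul, ← Finset.smul_sum]
    congr 1
    · exact Finset.sum_congr rfl fun i _ => by rw [← Finset.sum_smul, hβ.2, one_smul]
    · rw [← Finset.sum_smul, hα.2, one_smul]
  have h2 (i j : ι) : ‖(α i * β j) • (v i - v j)‖ ≤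
      α i * β j * D - if i = l ∧ j = l then ε ^ 2 * D else 0 := by
    have hnn := mul_nonneg (hα.1 i) (hβ.1 j)
    split_ifs with h
    · obtain ⟨rfl, rfl⟩ := h
      have := mul_le_mul hαl hβl hε (hα.1 _)
      simp only [sub_self, smul_zero, norm_zero]
      nlinarith
    · rw [norm_smul, Real.norm_of_nonneg hnn, sub_zero, ← dist_eq_norm]
      exact mul_le_mul_of_nonneg_left (hD i j) hnn
  rw [dist_eq_norm, h1]
  refine (norm_sum_le _ _).trans ?_
  refine (Finset.sum_le_sum fun i _ => (norm_sum_le _ _).trans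
    (Finset.sum_le_sum fun j _ => h2 i j)).trans (le_of_eq ?_)
  simp only [Finset.sum_sub_distrib, ← Finset.sum_mul, ← Finset.mul_sum, hβ.2, mul_one, hα.2,
    one_mul, ite_and]
  simp only [sub_mul, one_mul]
  congr 1
  rw [Finset.sum_eq_single l] <;> simp +contextual

/-- The vertices of the simplex attached to a word. -/
noncomputable def vertex (n : ℕ) (c : ℝ) (w : List Bool) (i : Fin (n + 1)) : Fin n → ℝ :=
  colPoint (V n * word n c w) i

theorem cell_eq_convexHull [NeZero n] {c : ℝ} (hc : 0 < c) (w : List Bool) :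
    cell n c w = convexHull ℝ (range (vertex n c w)) := (convexHull_range_word hc w).symm

theorem vertex_mem_cell (c : ℝ) (w : List Bool) (i : Fin (n + 1)) :
    vertex n c w i ∈ cell n c w :=
  ⟨Pi.single i 1, single_mem_cone i, by simp [vertex, colPoint_eq_pt]⟩

theorem diam_cell [NeZero n] {c : ℝ} (hc : 0 < c) (w : List Bool) :
    Metric.diam (cell n c w) = Metric.diam (range (vertex n c w)) := by
  rw [cell_eq_convexHull hc, convexHull_diam]

/-- The weights of a vertex of a small simplex with respect to the vertices of a larger one. -/
noncomputable def weight (n : ℕ) (c : ℝ) (w w' : List Bool) (j i : Fin (n + 1)) : ℝ :=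
  colSum (word n c w) i * word n c w' i j / colSum (word n c (w ++ w')) j

theorem colSum_word_append (c : ℝ) (w w' : List Bool) (j : Fin (n + 1)) :
    colSum (word n c (w ++ w')) j = ∑ i, colSum (word n c w) i * word n c w' i j := by
  rw [word_append, colSum_mul]
  rfl

theorem weight_mem_stdSimplex [NeZero n] {c : ℝ} (hc : 0 < c) (w w' : List Bool)
    (j : Fin (n + 1)) : weight n c w w' j ∈ stdSimplex ℝ (Fin (n + 1)) := by
  have hd := colSum_word_pos (n := n) hc (w ++ w') j
  refine ⟨fun i => div_nonneg (mul_nonneg (colSum_word_pos hc w i).le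
    (word_nonneg hc.le w' i j)) hd.le, ?_⟩
  simp only [weight]
  rw [← Finset.sum_div, ← colSum_word_append, div_self hd.ne']

theorem vertex_append [NeZero n] {c : ℝ} (hc : 0 < c) (w w' : List Bool) (j : Fin (n + 1)) :
    vertex n c (w ++ w') j = ∑ i, weight n c w w' j i • vertex n c w i := by
  have hd := colSum_word_pos (n := n) hc (w ++ w') j
  simp only [vertex]
  rw [sum_smul_colPoint (colSum_word_pos hc w) (weight_mem_stdSimplex hc w w' j).2,
    colPoint_eq_pt, ← pt_smul (inv_ne_zero hd.ne')]
  congr 1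
  have h : (fun i => weight n c w w' j i / colSum (word n c w) i) =
      (colSum (word n c (w ++ w')) j)⁻¹ • (word n c w').col j := by
    funext i
    have := (colSum_word_pos (n := n) hc w i).ne'
    simp only [weight, Pi.smul_apply, smul_eq_mul, col_apply]
    field_simp
  rw [h, mulVec_smul, word_append]
  rfl

theorem half_pow_le_word {c : ℝ} (hc : 1 / 2 ≤ c) (w : List Bool) (i j : Fin (n + 1))
    (h : word n c w i j ≠ 0) : (1 / 2) ^ w.length ≤ word n c w i j := by
  have hc0 : 0 ≤ c := le_trans (by norm_num) hc
  induction w generalizing i with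
  | nil =>
    simp only [word_nil, one_apply] at h ⊢
    split_ifs at h ⊢ <;> simp_all
  | cons a w ih =>
    rw [word_cons, mul_apply] at h ⊢
    obtain ⟨k, -, hk⟩ := Finset.exists_ne_zero_of_sum_ne_zero h
    have h1 : 1 / 2 ≤ stepMatrix n c a i k := by
      have h2 := left_ne_zero_of_mul hk
      simp only [stepMatrix, of_apply] at h2 ⊢
      split_ifs at h2 ⊢ <;> first | exact hc | exact absurd rfl h2 | norm_num
    have h2 := ih k (right_ne_zero_of_mul hk)
    calc (1 / 2 : ℝ) ^ (w.length + 1) = 1 / 2 * (1 / 2) ^ w.length := by ring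
      _ ≤ stepMatrix n c a i k * word n c w k j :=
        mul_le_mul h1 h2 (by positivity) (stepMatrix_nonneg hc0 a i k)
      _ ≤ _ := Finset.single_le_sum (f := fun k => stepMatrix n c a i k * word n c w k j)
        (fun k _ => mul_nonneg (stepMatrix_nonneg hc0 a i k) (word_nonneg hc0 w k j))
        (Finset.mem_univ k)

theorem colSum_word_le [NeZero n] {c : ℝ} (hc : 0 ≤ c) (hc1 : c ≤ 1) (w : List Bool)
    (j : Fin (n + 1)) : colSum (word n c w) j ≤ 2 ^ w.length := by
  induction w with
  | nil => simp [colSum, one_apply]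
  | cons a w ih =>
    rw [word_cons, colSum_mul]
    calc (colSum (stepMatrix n c a) ᵥ* word n c w) j
        ≤ ∑ k, 2 * word n c w k j := by
          change ∑ k, colSum (stepMatrix n c a) k * word n c w k j ≤ _
          refine Finset.sum_le_sum fun k _ =>
            mul_le_mul_of_nonneg_right ?_ (word_nonneg hc w k j)
          rw [colSum_stepMatrix]
          split_ifs <;> linarith
      _ = 2 * colSum (word n c w) j := by rw [← Finset.mul_sum]; rfl
      _ ≤ 2 ^ (w.length + 1) := by rw [pow_succ']; linarith

/-- The factor by which the cells shrink during the scrambling time, if at the start the last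
projective coordinates of the vertices are within a factor `2` of each other. -/
noncomputable def contractionFactor (n : ℕ) : ℝ := 1 - ((1 / 2) ^ (2 * scramblingTime n + 1)) ^ 2

theorem contractionFactor_nonneg : 0 ≤ contractionFactor n := by
  have h : ((1 / 2 : ℝ) ^ (2 * scramblingTime n + 1)) ≤ 1 :=
    pow_le_one₀ (by norm_num) (by norm_num)
  have h0 : (0 : ℝ) ≤ (1 / 2 : ℝ) ^ (2 * scramblingTime n + 1) := by positivity
  rw [contractionFactor]
  nlinarith

theorem contractionFactor_lt_one : contractionFactor n < 1 := by
  rw [contractionFactor]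
  have : (0 : ℝ) < ((1 / 2 : ℝ) ^ (2 * scramblingTime n + 1)) ^ 2 := by positivity
  linarith

/-- The nonzero weights are bounded below: the entries of the product are at least `2⁻ᵐ`, with `m` the
number of steps, and in `m` steps the denominators grow by a factor of at most `2 * 2 ^ m`. -/
theorem weight_ge [NeZero n] {c : ℝ} (hc : 1 / 2 ≤ c) (hc1 : c ≤ 1) {w w' : List Bool}
    (hd : ∀ i k, colSum (word n c w) i ≤ 2 * colSum (word n c w) k) {i j : Fin (n + 1)}
    (hij : word n c w' i j ≠ 0) : (1 / 2) ^ (2 * w'.length + 1) ≤ weight n c w w' j i := by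
  have hc0 : 0 < c := lt_of_lt_of_le (by norm_num) hc
  have hpos := colSum_word_pos (n := n) hc0 (w ++ w') j
  have hdi := colSum_word_pos (n := n) hc0 w i
  have h1 : colSum (word n c (w ++ w')) j ≤ 2 * colSum (word n c w) i * 2 ^ w'.length := by
    rw [colSum_word_append]
    calc ∑ k, colSum (word n c w) k * word n c w' k j
        ≤ ∑ k, 2 * colSum (word n c w) i * word n c w' k j :=
          Finset.sum_le_sum fun k _ =>
            mul_le_mul_of_nonneg_right (hd k i) (word_nonneg hc0.le w' k j)
      _ = 2 * colSum (word n c w) i * colSum (word n c w') j := by rw [← Finset.mul_sum]; rfl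
      _ ≤ _ := mul_le_mul_of_nonneg_left (colSum_word_le hc0.le hc1 w' j) (by positivity)
  rw [weight, le_div_iff₀ hpos]
  calc (1 / 2 : ℝ) ^ (2 * w'.length + 1) * colSum (word n c (w ++ w')) j
      ≤ (1 / 2) ^ (2 * w'.length + 1) * (2 * colSum (word n c w) i * 2 ^ w'.length) :=
        mul_le_mul_of_nonneg_left h1 (by positivity)
    _ = colSum (word n c w) i * (1 / 2) ^ w'.length * ((1 / 2) * 2) ^ w'.length := by
        rw [mul_pow, pow_succ, two_mul, pow_add]; ring
    _ = colSum (word n c w) i * (1 / 2) ^ w'.length := by norm_num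
    _ ≤ _ := mul_le_mul_of_nonneg_left (half_pow_le_word hc w' i j hij) hdi.le

theorem diam_cell_append_le [NeZero n] {c : ℝ} (hc : 1 / 2 ≤ c) (hc1 : c ≤ 1) {w w' : List Bool}
    (hd : ∀ i k, colSum (word n c w) i ≤ 2 * colSum (word n c w) k)
    (hw' : w'.length = scramblingTime n) :
    Metric.diam (cell n c (w ++ w')) ≤ contractionFactor n * Metric.diam (cell n c w) := by
  have hc0 : 0 < c := lt_of_lt_of_le (by norm_num) hc
  rw [diam_cell hc0 (w ++ w')]
  refine Metric.diam_le_of_forall_dist_le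
    (mul_nonneg contractionFactor_nonneg Metric.diam_nonneg) ?_
  rintro _ ⟨j, rfl⟩ _ ⟨k, rfl⟩
  obtain ⟨l, hlj, hlk⟩ := exists_common_row hc0 hw' j k
  rw [vertex_append hc0, vertex_append hc0, contractionFactor, ← hw']
  exact dist_combination_le
    (fun i i' => Metric.dist_le_diam_of_mem (isCompact_cell hc0 w).isBounded
      (vertex_mem_cell c w i) (vertex_mem_cell c w i'))
    (weight_mem_stdSimplex hc0 w w' j) (weight_mem_stdSimplex hc0 w w' k) (by positivity)
    (weight_ge hc hc1 hd hlj) (weight_ge hc hc1 hd hlk)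

theorem colSum_word_half [NeZero n] (w : List Bool) (j : Fin (n + 1)) :
    colSum (word n (1 / 2) w) j = 1 := by
  induction w with
  | nil => simp [colSum, one_apply]
  | cons a w ih =>
    rw [word_cons, colSum_mul]
    have : colSum (stepMatrix n (1 / 2) a) = fun _ => 1 := by
      funext k
      rw [colSum_stepMatrix]
      simp
    rw [this, ← colSum_eq_vecMul, ih]

/-- On the barycentric side the cells shrink uniformly. -/
theorem diam_baryCell_le [NeZero n] (k : ℕ) (w : List Bool) (hw : k * scramblingTime n ≤ w.length) :
    Metric.diam (cell n (1 / 2) w) ≤ contractionFactor n ^ k * Metric.diam (Delta n) := by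
  have hhalf : (0 : ℝ) < 1 / 2 := by norm_num
  have hbdd (u : List Bool) := (isCompact_cell (n := n) hhalf u).isBounded
  induction k generalizing w with
  | zero =>
    rw [pow_zero, one_mul, Delta_eq_cell hhalf]
    exact Metric.diam_mono (cell_append_subset hhalf [] w) (hbdd [])
  | succ k ih =>
    rw [Nat.succ_mul] at hw
    have hsplit : w = w.take (w.length - scramblingTime n) ++
      w.drop (w.length - scramblingTime n) := (List.take_append_drop _ _).symm
    rw [hsplit]
    refine (diam_cell_append_le le_rfl (by norm_num) (fun i k => ?_) ?_).trans ?_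
    · rw [colSum_word_half, colSum_word_half]; norm_num
    · rw [List.length_drop]; omega
    · rw [pow_succ', mul_assoc]
      refine mul_le_mul_of_nonneg_left (ih _ ?_) contractionFactor_nonneg
      rw [List.length_take]
      omega

/-! ### Denominators on the Farey side -/

theorem colSum_word_concat [NeZero n] (w : List Bool) (a : Bool) (j : Fin (n + 1)) :
    colSum (word n 1 (w ++ [a])) j =
      if (j : ℕ) = 0 then (if a then colSum (word n 1 w) 1 else colSum (word n 1 w) 0)
      else if h : (j : ℕ) = n then colSum (word n 1 w) 0 + colSum (word n 1 w) 1
      else colSum (word n 1 w) ⟨j + 1, by omega⟩ := by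
  rw [word_append, word_singleton, colSum_mul, vecMul_stepMatrix, one_mul]

/-- The denominators of the vertices are nondecreasing, and the last one is at most the sum of
the first two. -/
theorem colSum_word_mono [NeZero n] (w : List Bool) :
    Monotone (colSum (word n 1 w)) ∧
      colSum (word n 1 w) (Fin.last n) ≤ colSum (word n 1 w) 0 + colSum (word n 1 w) 1 := by
  have h1 := val_one_fin (n := n)
  have hn := NeZero.ne n
  induction w using List.reverseRecOn with
  | nil =>
    have : colSum (word n 1 []) = fun _ => 1 := by
      funext j; simp [colSum, one_apply]
    rw [this]
    exact ⟨fun _ _ _ => le_rfl, by norm_num⟩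
  | append_singleton w a ih =>
    obtain ⟨hm, hl⟩ := ih
    have hpos := colSum_word_pos (n := n) one_pos w
    have hlast (j : Fin (n + 1)) : colSum (word n 1 w) j ≤
        colSum (word n 1 w) 0 + colSum (word n 1 w) 1 := (hm (Fin.le_last j)).trans hl
    have h01 : colSum (word n 1 w) 0 ≤ colSum (word n 1 w) 1 := hm (Fin.zero_le _)
    have hmono : Monotone (colSum (word n 1 (w ++ [a]))) := by
      intro i j hij
      have hij' : (i : ℕ) ≤ j := hij
      rw [colSum_word_concat, colSum_word_concat]
      split_ifs with ha hb hc hd he hf hg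
      all_goals first
        | exact le_rfl
        | omega
        | exact hlast _
        | exact hm (Fin.zero_le _)
        | exact hm (by rw [Fin.le_def]; simp only [h1]; omega)
    refine ⟨hmono, ?_⟩
    have hge : colSum (word n 1 w) 1 ≤ colSum (word n 1 (w ++ [a])) 1 := by
      rw [colSum_word_concat]
      split_ifs with hb hc hd
      · omega
      · omega
      · linarith [hpos 0]
      · exact hm (by rw [Fin.le_def]; simp only [h1]; omega)
    have h2 : colSum (word n 1 (w ++ [a])) (Fin.last n) =
        colSum (word n 1 w) 0 + colSum (word n 1 w) 1 := by
      rw [colSum_word_concat, if_neg (by simpa using hn), dif_pos (by simp)]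
    have h3 : colSum (word n 1 w) 0 ≤ colSum (word n 1 (w ++ [a])) 0 := by
      rw [colSum_word_concat, if_pos (by simp)]
      split_ifs <;> linarith
    linarith

/-- After a letter `1` the smallest denominator is the former `d₁` and the largest is `d₀ + d₁ ≤ 2 d₁`. -/
theorem colSum_word_concat_true [NeZero n] (w : List Bool) (i k : Fin (n + 1)) :
    colSum (word n 1 (w ++ [true])) i ≤ 2 * colSum (word n 1 (w ++ [true])) k := by
  have hm := (colSum_word_mono (n := n) (w ++ [true])).1
  have h01 : colSum (word n 1 w) 0 ≤ colSum (word n 1 w) 1 := (colSum_word_mono w).1 (Fin.zero_le _)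
  have h2 : colSum (word n 1 (w ++ [true])) (Fin.last n) =
      colSum (word n 1 w) 0 + colSum (word n 1 w) 1 := by
    rw [colSum_word_concat, if_neg (by simpa using NeZero.ne n), dif_pos (by simp)]
  have h3 : colSum (word n 1 (w ++ [true])) 0 = colSum (word n 1 w) 1 := by
    rw [colSum_word_concat, if_pos (by simp), if_pos rfl]
  have h4 := hm (Fin.le_last i)
  have h5 := hm (Fin.zero_le k)
  linarith

/-! ### The point determined by an infinite word -/

theorem initialWord_zero (a : ℕ → Bool) : initialWord a 0 = [] := rfl

theorem initialWord_succ (a : ℕ → Bool) (t : ℕ) :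
    initialWord a (t + 1) = initialWord a t ++ [a t] := by
  simp [initialWord, List.range_succ]

theorem initialWord_succ_eq_cons (a : ℕ → Bool) (t : ℕ) :
    initialWord a (t + 1) = a 0 :: initialWord (fun k => a (k + 1)) t := by
  simp [initialWord, List.range_succ_eq_map, Function.comp_def]

@[simp] theorem length_initialWord (a : ℕ → Bool) (t : ℕ) : (initialWord a t).length = t := by
  simp [initialWord]

theorem initialWord_add (a : ℕ → Bool) (s t : ℕ) :
    initialWord a (s + t) = initialWord a s ++ initialWord (fun k => a (s + k)) t := by
  simp [initialWord, List.range_add, Function.comp_def]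

/-- The point `p` belongs to all the cells along the infinite word `a`. -/
def IsLimit (n : ℕ) (c : ℝ) (a : ℕ → Bool) (p : Fin n → ℝ) : Prop :=
  ∀ t, p ∈ cell n c (initialWord a t)

theorem antitone_cell [NeZero n] {c : ℝ} (hc : 0 < c) (a : ℕ → Bool) :
    Antitone fun t => cell n c (initialWord a t) :=
  antitone_nat_of_succ_le fun t => by
    rw [initialWord_succ]
    exact cell_append_subset hc _ _

theorem exists_isLimit [NeZero n] {c : ℝ} (hc : 0 < c) (a : ℕ → Bool) : ∃ p, IsLimit n c a p := by
  obtain ⟨p, hp⟩ := IsCompact.nonempty_iInter_of_sequence_nonempty_isCompact_isClosed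
    (fun t => cell n c (initialWord a t)) (fun t => antitone_cell hc a (Nat.le_succ t))
    (fun t => cell_nonempty c _) (isCompact_cell hc _) fun t => (isCompact_cell hc _).isClosed
  exact ⟨p, fun t => mem_iInter.1 hp t⟩

/-- A limit point for a word is obtained by applying the step matrix of the first letter to a limit
point for the rest of the word. -/
theorem isLimit_stepMatrix_iff [NeZero n] {c : ℝ} (hc : 0 < c) (a : ℕ → Bool)
    {y : Fin (n + 1) → ℝ} (hy : y ∈ cone n univ) :
    IsLimit n c a (pt (stepMatrix n c (a 0) *ᵥ y)) ↔ IsLimit n c (fun k => a (k + 1)) (pt y) := by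
  have hstep {z : Fin (n + 1) → ℝ} (hz : z ∈ cone n univ) :=
    mulVec_mem_cone (stepMatrix_nonneg hc.le (a 0)) (colSum_stepMatrix_pos hc (a 0)) hz
  constructor
  · intro h t
    obtain ⟨z, hz, h1⟩ := h (t + 1)
    simp only [initialWord_succ_eq_cons, word_cons, ← mulVec_mulVec] at h1
    have hz' := word_mulVec_mem_cone hc (initialWord (fun k => a (k + 1)) t) hz
    obtain ⟨r, hr, h2⟩ := exists_pos_smul_of_pt_eq (hstep hy) (hstep hz') h1.symm
    rw [← mulVec_smul] at h2
    refine ⟨z, hz, ?_⟩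
    change pt _ = _
    rw [stepMatrix_mulVec_injective hc _ h2, pt_smul hr.ne']
  · rintro h (_ | t)
    · exact ⟨_, hstep hy, by simp [initialWord_zero]⟩
    · obtain ⟨z, hz, h1⟩ := h t
      have hz' := word_mulVec_mem_cone hc (initialWord (fun k => a (k + 1)) t) hz
      obtain ⟨r, hr, h2⟩ := exists_pos_smul_of_pt_eq hy hz' h1.symm
      refine ⟨z, hz, ?_⟩
      simp only [initialWord_succ_eq_cons, word_cons, ← mulVec_mulVec]
      rw [h2, mulVec_smul, pt_smul hr.ne']

/-- Every point of `Δ` has an itinerary. -/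
theorem exists_isLimit_of_mem_Delta [NeZero n] {c : ℝ} (hc : 0 < c) {p : Fin n → ℝ}
    (hp : p ∈ Delta n) : ∃ a, IsLimit n c a p := by
  obtain ⟨y, hy, rfl⟩ := mem_Delta_iff.1 hp
  have hex : ∀ z : cone n univ, ∃ q : Bool × cone n univ, stepMatrix n c q.1 *ᵥ q.2 = z := by
    rintro ⟨z, hz⟩
    obtain ⟨a, z', hz', h⟩ := exists_stepMatrix_mulVec hc hz
    exact ⟨(a, ⟨z', hz'⟩), h⟩
  choose f hf using hex
  let g : ℕ → cone n univ := fun t => (fun z => (f z).2)^[t] ⟨y, hy⟩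
  refine ⟨fun t => (f (g t)).1, fun t => ⟨g t, (g t).2, ?_⟩⟩
  change pt _ = _
  congr 1
  induction t with
  | zero => simp [initialWord_zero, g]
  | succ t ih =>
    have h1 : g (t + 1) = (f (g t)).2 := Function.iterate_succ_apply' _ _ _
    rw [initialWord_succ, word_append, word_singleton, ← mulVec_mulVec, h1, hf, ih]

theorem IsLimit.mem_Delta [NeZero n] {c : ℝ} (hc : 0 < c) {a : ℕ → Bool} {p : Fin n → ℝ}
    (h : IsLimit n c a p) : p ∈ Delta n := cell_subset_Delta hc _ (h 0)

/-- Along the constant word `000…` the Farey cells shrink to the vertex number `0`. -/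
theorem eq_of_isLimit_false [NeZero n] {p : Fin n → ℝ} (hp : IsLimit n 1 (fun _ => false) p) :
    p = pt (Pi.single 0 1) := by
  obtain ⟨z, hz, rfl⟩ := mem_Delta_iff.1 (hp.mem_Delta one_pos)
  -- The row `s` is fixed by the step matrix, while `l` grows by `s` at each step.
  let s : Fin (n + 1) → ℝ := fun j => if (j : ℕ) = 0 then 0 else 1
  let l : Fin (n + 1) → ℝ := fun j => if (j : ℕ) = 0 then n else (j : ℕ)
  have hn := NeZero.ne n
  have h1 := val_one_fin (n := n)
  have hs0 (j : Fin (n + 1)) : 0 ≤ s j := by simp only [s]; split_ifs <;> norm_num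
  have hl0 (j : Fin (n + 1)) : 0 ≤ l j := by simp only [l]; split_ifs <;> positivity
  have hs : s ᵥ* stepMatrix n 1 false = s := by
    funext j
    rw [vecMul_stepMatrix]
    simp only [s, h1]
    split_ifs <;> simp_all
  have hl : l ᵥ* stepMatrix n 1 false = l + s := by
    funext j
    rw [vecMul_stepMatrix]
    simp only [l, s, h1, Pi.add_apply]
    split_ifs <;> simp_all
  have hws (t : ℕ) : s ᵥ* word n 1 (initialWord (fun _ => false) t) = s := by
    induction t with
    | zero => simp [initialWord_zero]
    | succ t ih => rw [initialWord_succ, word_append, word_singleton, ← vecMul_vecMul, ih, hs]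
  have hwl (t : ℕ) : l ᵥ* word n 1 (initialWord (fun _ => false) t) = l + (t : ℝ) • s := by
    induction t with
    | zero => simp [initialWord_zero]
    | succ t ih =>
      rw [initialWord_succ, word_append, word_singleton, ← vecMul_vecMul, ih, add_vecMul,
        smul_vecMul, hs, hl]
      push_cast
      module
  have hle (t : ℕ) : t * (s ⬝ᵥ z) ≤ l ⬝ᵥ z := by
    obtain ⟨y, hy, h⟩ := hp t
    obtain ⟨r, hr, h2⟩ := exists_pos_smul_of_pt_eq hz (word_mulVec_mem_cone one_pos _ hy) h.symm
    rw [h2, dotProduct_smul, dotProduct_smul, dotProduct_mulVec, dotProduct_mulVec, hws, hwl,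
      add_dotProduct, smul_dotProduct]
    have : 0 ≤ l ⬝ᵥ y := Finset.sum_nonneg fun j _ => mul_nonneg (hl0 j) (hy.1 j)
    simp only [smul_eq_mul]
    nlinarith [mul_nonneg hr.le this]
  have hsz : s ⬝ᵥ z = 0 := by
    have h0 : 0 ≤ s ⬝ᵥ z := Finset.sum_nonneg fun j _ => mul_nonneg (hs0 j) (hz.1 j)
    by_contra hne
    have hpos := lt_of_le_of_ne h0 (Ne.symm hne)
    obtain ⟨t, ht⟩ := exists_nat_gt ((l ⬝ᵥ z) / (s ⬝ᵥ z))
    rw [div_lt_iff₀ hpos] at ht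
    exact absurd (hle t) (not_le.2 ht)
  have hzj (j : Fin (n + 1)) (hj : j ≠ 0) : z j = 0 := by
    have h2 := (Finset.sum_eq_zero_iff_of_nonneg fun j _ =>
      mul_nonneg (hs0 j) (hz.1 j)).1 hsz j (Finset.mem_univ j)
    have h3 : (j : ℕ) ≠ 0 := fun h => hj (Fin.ext h)
    simp only [s, h3, if_false, one_mul] at h2
    exact h2
  have hz0 : z = z 0 • Pi.single 0 1 := by
    funext j
    rcases eq_or_ne j 0 with rfl | hj
    · simp
    · simp [hzj j hj, hj]
  rw [hz0, pt_smul]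
  intro h
  have := hz.2.1
  rw [hz0, h] at this
  simp at this

/-- Every infinite word determines at most one point. -/
def LimitsUnique (n : ℕ) (c : ℝ) : Prop :=
  ∀ a p q, IsLimit n c a p → IsLimit n c a q → p = q

theorem eq_of_dist_le_pow {p q : Fin n → ℝ} {D : ℝ}
    (h : ∀ k : ℕ, dist p q ≤ contractionFactor n ^ k * D) : p = q := by
  have h1 : Tendsto (fun k : ℕ => contractionFactor n ^ k * D) atTop (𝓝 (0 * D)) :=
    (tendsto_pow_atTop_nhds_zero_of_lt_one contractionFactor_nonneg
      contractionFactor_lt_one).mul_const D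
  rw [zero_mul] at h1
  exact dist_le_zero.1 (ge_of_tendsto' h1 h)

theorem limitsUnique_half [NeZero n] : LimitsUnique n (1 / 2) := fun a p q hp hq =>
  eq_of_dist_le_pow (D := Metric.diam (Delta n)) fun k =>
    (Metric.dist_le_diam_of_mem (isCompact_cell (by norm_num) _).isBounded
      (hp (k * scramblingTime n)) (hq _)).trans (diam_baryCell_le k _ (by simp))

theorem eq_of_isLimit_of_frequently_true [NeZero n] {a : ℕ → Bool}
    (ha : ∀ t, ∃ s, t ≤ s ∧ a s = true) {p q : Fin n → ℝ} (hp : IsLimit n 1 a p)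
    (hq : IsLimit n 1 a q) : p = q := by
  have hbdd (t : ℕ) := (isCompact_cell (n := n) one_pos (initialWord a t)).isBounded
  have key (k : ℕ) : ∃ t, Metric.diam (cell n 1 (initialWord a t)) ≤
      contractionFactor n ^ k * Metric.diam (cell n 1 (initialWord a 0)) := by
    induction k with
    | zero => exact ⟨0, by simp⟩
    | succ k ih =>
      obtain ⟨t, ht⟩ := ih
      obtain ⟨s, hts, hs⟩ := ha t
      refine ⟨s + 1 + scramblingTime n, ?_⟩
      rw [initialWord_add]
      refine (diam_cell_append_le (by norm_num) le_rfl (fun i k => ?_) (by simp)).trans ?_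
      · rw [initialWord_succ, hs]
        exact colSum_word_concat_true _ i k
      · rw [pow_succ', mul_assoc]
        refine mul_le_mul_of_nonneg_left (le_trans ?_ ht) contractionFactor_nonneg
        exact Metric.diam_mono (antitone_cell one_pos a (by omega)) (hbdd t)
  refine eq_of_dist_le_pow (D := Metric.diam (cell n 1 (initialWord a 0))) fun k => ?_
  obtain ⟨t, ht⟩ := key k
  exact (Metric.dist_le_diam_of_mem (hbdd t) (hp t) (hq t)).trans ht

theorem limitsUnique_one [NeZero n] : LimitsUnique n 1 := by
  intro a p q hp hq
  by_cases ha : ∀ t, ∃ s, t ≤ s ∧ a s = true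
  · exact eq_of_isLimit_of_frequently_true ha hp hq
  push Not at ha
  obtain ⟨t, ht⟩ := ha
  induction t generalizing a p q with
  | zero =>
    obtain rfl : a = fun _ => false := funext fun s => by simpa using ht s (Nat.zero_le s)
    rw [eq_of_isLimit_false hp, eq_of_isLimit_false hq]
  | succ t ih =>
    -- The first letter can be removed from the word.
    have hpre {p : Fin n → ℝ} (hp : IsLimit n 1 a p) : ∃ y ∈ cone n univ,
        p = pt (stepMatrix n 1 (a 0) *ᵥ y) ∧ IsLimit n 1 (fun k => a (k + 1)) (pt y) := by
      obtain ⟨y, hy, rfl⟩ := hp 1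
      have h1 : initialWord a 1 = [a 0] := rfl
      simp only [h1, word_singleton] at hp ⊢
      exact ⟨y, hy, rfl, (isLimit_stepMatrix_iff one_pos a hy).1 hp⟩
    obtain ⟨y, hy, rfl, hy'⟩ := hpre hp
    obtain ⟨z, hz, rfl, hz'⟩ := hpre hq
    have h1 := ih _ _ _ hy' hz' fun s hs => ht (s + 1) (Nat.succ_le_succ hs)
    obtain ⟨r, hr, h2⟩ := exists_pos_smul_of_pt_eq hy hz h1
    rw [h2, mulVec_smul, pt_smul hr.ne']

/-- The cells along an infinite word are eventually contained in any neighborhood of the limit. -/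
theorem exists_cell_subset [NeZero n] {c : ℝ} (hc : 0 < c) (hu : LimitsUnique n c) {a : ℕ → Bool}
    {p : Fin n → ℝ} (hp : IsLimit n c a p) {U : Set (Fin n → ℝ)} (hU : U ∈ 𝓝 p) :
    ∃ t, cell n c (initialWord a t) ⊆ U := by
  refine exists_subset_nhds_of_isCompact' (V := fun t => cell n c (initialWord a t))
    (antitone_cell hc a).directed_ge (fun t => isCompact_cell hc _)
    (fun t => (isCompact_cell hc _).isClosed) fun x hx => ?_
  rwa [hu a x p (fun t => mem_iInter.1 hx t) hp]

theorem iInter_cell_eq_singleton {c : ℝ} (hu : LimitsUnique n c) {a : ℕ → Bool}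
    {p : Fin n → ℝ} (hp : IsLimit n c a p) : ⋂ t, cell n c (initialWord a t) = {p} := by
  ext q
  simp only [mem_iInter, mem_singleton_iff]
  exact ⟨fun hq => hu a q p hq hp, fun h => h ▸ hp⟩

theorem isLimit_phi [NeZero n] (a : ℕ → Bool) : IsLimit n 1 a (phi n a) := by
  obtain ⟨p, hp⟩ := exists_isLimit (n := n) one_pos a
  have h : ∃ p, p ∈ ⋂ t, fareyCell n (initialWord a t) :=
    ⟨p, mem_iInter.2 fun t => by rw [fareyCell_eq_cell]; exact hp t⟩
  intro t
  rw [← fareyCell_eq_cell]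
  exact mem_iInter.1 (Classical.epsilon_spec h) t

theorem isLimit_upsilon [NeZero n] (a : ℕ → Bool) : IsLimit n (1 / 2) a (upsilon n a) := by
  obtain ⟨p, hp⟩ := exists_isLimit (n := n) (c := 1 / 2) (by norm_num) a
  have h : ∃ p, p ∈ ⋂ t, baryCell n (initialWord a t) :=
    ⟨p, mem_iInter.2 fun t => by rw [baryCell_eq_cell]; exact hp t⟩
  intro t
  rw [← baryCell_eq_cell]
  exact mem_iInter.1 (Classical.epsilon_spec h) t

/-- Which infinite words determine the same point does not depend on the parameter. -/
theorem isLimit_transfer [NeZero n] {c c' : ℝ} (hc : 0 < c) (hc' : 0 < c')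
    (hu : LimitsUnique n c') {a b : ℕ → Bool} {p q q' : Fin n → ℝ} (ha : IsLimit n c a p)
    (hb : IsLimit n c b p) (ha' : IsLimit n c' a q) (hb' : IsLimit n c' b q') : q = q' := by
  have hne (t : ℕ) : (cell n c' (initialWord a t) ∩ cell n c' (initialWord b t)).Nonempty := by
    obtain ⟨y, hy, h1⟩ := ha t
    obtain ⟨z, hz, h2⟩ := hb t
    obtain ⟨r, hr, h3⟩ := exists_pos_smul_of_pt_eq (word_mulVec_mem_cone hc _ hy)
      (word_mulVec_mem_cone hc _ hz) (h1.trans h2.symm)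
    rw [← mulVec_smul] at h3
    have hz' := smul_mem_cone hz hr
    have h4 := sum_smul_eq_of_word_mulVec_eq hc hc' (initialWord a t) (initialWord b t) (by simp)
      y (r • z) hy.1 hz'.1 h3 fun _ v => v
    have h5 (w : List Bool) (u : Fin (n + 1) → ℝ) :
        ∑ i, u i • (word n c' w).col i = word n c' w *ᵥ u := by
      funext k
      simp [mulVec, dotProduct, mul_comm]
    rw [h5, h5] at h4
    exact ⟨_, ⟨y, hy, rfl⟩, ⟨r • z, hz', by simp only [h4]⟩⟩
  obtain ⟨x, hx⟩ := IsCompact.nonempty_iInter_of_sequence_nonempty_isCompact_isClosed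
    (fun t => cell n c' (initialWord a t) ∩ cell n c' (initialWord b t))
    (fun t => inter_subset_inter (antitone_cell hc' a (Nat.le_succ t))
      (antitone_cell hc' b (Nat.le_succ t)))
    hne ((isCompact_cell hc' _).inter (isCompact_cell hc' _))
    fun t => ((isCompact_cell hc' _).inter (isCompact_cell hc' _)).isClosed
  rw [mem_iInter] at hx
  exact (hu a q x ha' fun t => (hx t).1).trans (hu b x q' (fun t => (hx t).2) hb')

theorem Phi_phi [NeZero n] (a : ℕ → Bool) : Phi n (phi n a) = upsilon n a := by
  have h := Classical.epsilon_spec (p := fun b : ℕ → Bool => phi n b = phi n a) ⟨a, rfl⟩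
  have h1 := isLimit_phi (n := n) (Classical.epsilon fun b => phi n b = phi n a)
  rw [h] at h1
  exact isLimit_transfer one_pos (by norm_num) limitsUnique_half h1 (isLimit_phi a)
    (isLimit_upsilon _) (isLimit_upsilon a)

theorem phi_eq_of_upsilon_eq [NeZero n] {a b : ℕ → Bool} (h : upsilon n a = upsilon n b) :
    phi n a = phi n b :=
  isLimit_transfer (c := 1 / 2) (by norm_num) one_pos limitsUnique_one (isLimit_upsilon a)
    (h ▸ isLimit_upsilon b) (isLimit_phi a) (isLimit_phi b)

theorem phi_eq_of_isLimit [NeZero n] {a : ℕ → Bool} {p : Fin n → ℝ} (h : IsLimit n 1 a p) :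
    phi n a = p := limitsUnique_one a _ _ (isLimit_phi a) h

theorem upsilon_eq_of_isLimit [NeZero n] {a : ℕ → Bool} {p : Fin n → ℝ}
    (h : IsLimit n (1 / 2) a p) : upsilon n a = p :=
  limitsUnique_half a _ _ (isLimit_upsilon a) h

theorem range_phi [NeZero n] : range (phi n) = Delta n := by
  apply Subset.antisymm
  · rintro _ ⟨a, rfl⟩
    exact (isLimit_phi a).mem_Delta one_pos
  · intro p hp
    obtain ⟨a, ha⟩ := exists_isLimit_of_mem_Delta one_pos hp
    exact ⟨a, phi_eq_of_isLimit ha⟩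

/-! ### Continuity -/

theorem continuousOn_range_of_comp {X Y Z : Type*} [TopologicalSpace X] [CompactSpace X]
    [TopologicalSpace Y] [T2Space Y] [TopologicalSpace Z] {p : X → Y} {f : Y → Z}
    (hp : Continuous p) (hfp : Continuous (f ∘ p)) : ContinuousOn f (range p) := by
  rw [continuousOn_iff_continuous_domRestrict]
  have hq : IsQuotientMap (rangeFactorization p) :=
    hp.rangeFactorization.isClosedMap.isQuotientMap hp.rangeFactorization
      rangeFactorization_surjective
  exact hq.continuous_iff.2 hfp

/-- A continuous injection of a compact set is a homeomorphism onto its image. -/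
theorem restrictsToHomeo_of_isCompact {f : (Fin n → ℝ) → (Fin n → ℝ)} {K L : Set (Fin n → ℝ)}
    (hK : IsCompact K) (hf : ContinuousOn f K) (hinj : InjOn f K) (hL : f '' K = L) :
    RestrictsToHomeo f K L := by
  subst hL
  have := isCompact_iff_compactSpace.1 hK
  have hc : Continuous (hinj.bijOn_image.equiv f) :=
    (continuousOn_iff_continuous_domRestrict.1 hf).subtype_mk _
  exact ⟨hc.homeoOfEquivCompactToT2, fun x => rfl⟩

theorem continuousOn_pt : ContinuousOn (pt (n := n)) {y | ∑ i, y i ≠ 0} := by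
  rw [continuousOn_pi]
  intro k
  have h (i : Fin (n + 1)) : Continuous fun y : Fin (n + 1) → ℝ => (V n *ᵥ y) i := by
    simp only [mulVec, dotProduct]
    fun_prop
  refine ContinuousOn.div (h _).continuousOn (h _).continuousOn fun y hy => ?_
  rw [V_mulVec_last]
  exact hy

theorem continuous_pt_word [NeZero n] {c : ℝ} (hc : 0 < c) (w : List Bool) :
    Continuous fun α : stdSimplex ℝ (Fin (n + 1)) => pt (word n c w *ᵥ (α : Fin (n + 1) → ℝ)) := by
  refine continuousOn_pt.comp_continuous ?_ fun α =>
    (word_mulVec_mem_cone hc w (stdSimplex_subset_cone α.2)).2.1.ne'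
  refine continuous_pi fun i => ?_
  simp only [mulVec, dotProduct]
  exact continuous_finsetSum _ fun j _ =>
    continuous_const.mul ((continuous_apply j).comp continuous_subtype_val)

theorem range_pt_word (c : ℝ) (w : List Bool) :
    range (fun α : stdSimplex ℝ (Fin (n + 1)) => pt (word n c w *ᵥ (α : Fin (n + 1) → ℝ))) =
      cell n c w := by
  apply Subset.antisymm
  · rintro _ ⟨α, rfl⟩
    exact ⟨α, stdSimplex_subset_cone α.2, rfl⟩
  · rintro _ ⟨y, hy, rfl⟩
    have hs := hy.2.1
    refine ⟨⟨(∑ i, y i)⁻¹ • y, (smul_mem_cone hy (inv_pos.2 hs)).1, ?_⟩, ?_⟩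
    · simp only [Pi.smul_apply, smul_eq_mul, ← Finset.mul_sum]
      exact inv_mul_cancel₀ hs.ne'
    · change pt (word n c w *ᵥ ((∑ i, y i)⁻¹ • y)) = pt (word n c w *ᵥ y)
      rw [mulVec_smul, pt_smul (inv_ne_zero hs.ne')]

/-- The point determined by an infinite word depends continuously on the word. -/
theorem continuous_of_isLimit [NeZero n] {c : ℝ} (hc : 0 < c) (hu : LimitsUnique n c)
    {f : (ℕ → Bool) → (Fin n → ℝ)} (hf : ∀ a, IsLimit n c a (f a)) : Continuous f := by
  rw [continuous_iff_continuousAt]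
  intro a U hU
  obtain ⟨t, ht⟩ := exists_cell_subset hc hu (hf a) hU
  have h1 : ∀ᶠ b in 𝓝 a, ∀ i ∈ Finset.range t, b i = a i := by
    rw [Filter.eventually_all_finset]
    intro i _
    have h2 := (continuous_apply (A := fun _ : ℕ => Bool) i).continuousAt (x := a)
    rw [ContinuousAt, nhds_discrete Bool, tendsto_pure] at h2
    exact h2
  change ∀ᶠ b in 𝓝 a, f b ∈ U
  filter_upwards [h1] with b hb
  have h2 : initialWord b t = initialWord a t :=
    List.map_congr_left fun i hi => hb i (by simpa using hi)
  exact ht (h2 ▸ hf b t)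

/-! ### The Minkowski function -/

theorem continuousOn_Phi [NeZero n] : ContinuousOn (Phi n) (Delta n) := by
  rw [← range_phi]
  refine continuousOn_range_of_comp (continuous_of_isLimit one_pos limitsUnique_one isLimit_phi) ?_
  have h : Phi n ∘ phi n = upsilon n := funext Phi_phi
  rw [h]
  exact continuous_of_isLimit (by norm_num) limitsUnique_half isLimit_upsilon

theorem injOn_Phi [NeZero n] : InjOn (Phi n) (Delta n) := by
  rw [← range_phi]
  rintro _ ⟨a, rfl⟩ _ ⟨b, rfl⟩ h
  rw [Phi_phi, Phi_phi] at h
  exact phi_eq_of_upsilon_eq h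

/-- The infinite word obtained by putting a finite word before an infinite one. -/
def prepend : List Bool → (ℕ → Bool) → ℕ → Bool
  | [], a => a
  | b :: w, a => fun k => Nat.casesOn k b (prepend w a)

theorem isLimit_prepend [NeZero n] {c : ℝ} (hc : 0 < c) (w : List Bool) {a : ℕ → Bool}
    {y : Fin (n + 1) → ℝ} (hy : y ∈ cone n univ) (h : IsLimit n c a (pt y)) :
    IsLimit n c (prepend w a) (pt (word n c w *ᵥ y)) := by
  induction w with
  | nil => simpa [prepend] using h
  | cons b w ih =>
    rw [word_cons, ← mulVec_mulVec]
    exact (isLimit_stepMatrix_iff hc (prepend (b :: w) a) (word_mulVec_mem_cone hc w hy)).2 ih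

/-- The conjugacy of the branches, in homogeneous coordinates. -/
theorem Phi_pt_word [NeZero n] (w : List Bool) {a : ℕ → Bool} {y z : Fin (n + 1) → ℝ}
    (hy : y ∈ cone n univ) (hz : z ∈ cone n univ) (hya : IsLimit n 1 a (pt y))
    (hza : IsLimit n (1 / 2) a (pt z)) :
    Phi n (pt (word n 1 w *ᵥ y)) = pt (word n (1 / 2) w *ᵥ z) := by
  rw [← phi_eq_of_isLimit (isLimit_prepend one_pos w hy hya), Phi_phi,
    upsilon_eq_of_isLimit (isLimit_prepend (by norm_num) w hz hza)]

theorem Mword_pt [NeZero n] (w : List Bool) {y : Fin (n + 1) → ℝ} (hy : y ∈ cone n univ) :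
    Mword n w (pt (word n 1 w *ᵥ y)) = pt y := by
  induction w with
  | nil => simp [Mword]
  | cons a w ih =>
    rw [word_cons, ← mulVec_mulVec, Mword, Function.comp_apply,
      Mbranch_pt a (word_mulVec_mem_cone one_pos w hy), ih]

theorem Tword_pt [NeZero n] (w : List Bool) {y : Fin (n + 1) → ℝ} (hy : y ∈ cone n univ) :
    Tword n w (pt (word n (1 / 2) w *ᵥ y)) = pt y := by
  induction w with
  | nil => simp [Tword]
  | cons a w ih =>
    rw [word_cons, ← mulVec_mulVec, Tword, Function.comp_apply,
      Tbranch_pt a (word_mulVec_mem_cone (by norm_num) w hy), ih]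

theorem restrictsToHomeo_Mword [NeZero n] (w : List Bool) :
    RestrictsToHomeo (Mword n w) (fareyCell n w) (Delta n) := by
  rw [fareyCell_eq_cell]
  refine restrictsToHomeo_of_isCompact (isCompact_cell one_pos w) ?_ ?_ ?_
  · rw [← range_pt_word]
    refine continuousOn_range_of_comp (continuous_pt_word one_pos w) ?_
    refine (continuous_pt_word (n := n) one_pos []).congr fun α => ?_
    rw [word_nil, one_mulVec]
    exact (Mword_pt w (stdSimplex_subset_cone α.2)).symm
  · rintro _ ⟨y, hy, rfl⟩ _ ⟨z, hz, rfl⟩ h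
    simp only [Mword_pt w hy, Mword_pt w hz] at h
    obtain ⟨r, hr, h1⟩ := exists_pos_smul_of_pt_eq hy hz h
    simp only [h1, mulVec_smul, pt_smul hr.ne']
  · rw [cell, image_image]
    ext x
    rw [mem_Delta_iff]
    constructor
    · rintro ⟨y, hy, rfl⟩
      exact ⟨y, hy, (Mword_pt w hy).symm⟩
    · rintro ⟨y, hy, rfl⟩
      exact ⟨y, hy, Mword_pt w hy⟩

theorem Phi_eq_Tword_Phi [NeZero n] (w : List Bool) {x : Fin n → ℝ} (hx : x ∈ Delta n) :
    Phi n x = Tword n w (Phi n (Function.invFunOn (Mword n w) (fareyCell n w) x)) := by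
  rw [fareyCell_eq_cell]
  obtain ⟨y, hy, rfl⟩ := mem_Delta_iff.1 hx
  have hex : ∃ z ∈ cell n 1 w, Mword n w z = pt y := ⟨_, ⟨y, hy, rfl⟩, Mword_pt w hy⟩
  obtain ⟨y', hy', h1⟩ := Function.invFunOn_mem hex
  have h2 := Function.invFunOn_eq hex
  simp only at h1
  rw [← h1, Mword_pt w hy'] at h2
  obtain ⟨a, ha⟩ := exists_isLimit_of_mem_Delta one_pos hx
  obtain ⟨z, hz, hza⟩ := mem_Delta_iff.1 ((isLimit_upsilon (n := n) a).mem_Delta (by norm_num))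
  have hza' := isLimit_upsilon (n := n) a
  rw [← hza] at hza'
  rw [← h1, Phi_pt_word w hy' hz (h2 ▸ ha) hza', Tword_pt w hz, hza, ← Phi_phi,
    phi_eq_of_isLimit ha]

/-- The barycentric coordinates of a point, as continuous functions on all of `ℝⁿ`. -/
noncomputable def coord (x : Fin n → ℝ) (j : Fin (n + 1)) : ℝ := ((V n)⁻¹ *ᵥ lift x) j

theorem coord_pt {y : Fin (n + 1) → ℝ} (hy : y ∈ cone n univ) (j : Fin (n + 1)) :
    coord (pt y) j = (∑ i, y i)⁻¹ * y j := by
  rw [coord, lift_pt hy.2.1.ne', mulVec_smul, mulVec_mulVec, nonsing_inv_mul _ isUnit_det_V,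
    one_mulVec]
  rfl

theorem continuous_coord (j : Fin (n + 1)) : Continuous fun x : Fin n → ℝ => coord x j := by
  simp only [coord, mulVec, dotProduct]
  refine continuous_finsetSum _ fun i _ => continuous_const.mul ?_
  refine Fin.lastCases ?_ (fun i => ?_) i
  · simp only [lift, Fin.snoc_last]
    exact continuous_const
  · simp only [lift, Fin.snoc_castSucc]
    exact continuous_apply i

/-- The limit points for two parameters lie on the same faces of `Δ`: a cell that meets the face
opposite to the vertex number `j` has a vertex on it, and so does the corresponding cell for the
other parameter. -/
theorem IsLimit.coord_eq_zero [NeZero n] {c c' : ℝ} (hc : 0 < c) (hc' : 0 < c')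
    (hu : LimitsUnique n c') {a : ℕ → Bool} {y z : Fin (n + 1) → ℝ} (hy : y ∈ cone n univ)
    (hz : z ∈ cone n univ) (hya : IsLimit n c a (pt y)) (hza : IsLimit n c' a (pt z))
    {j : Fin (n + 1)} (hj : y j = 0) : z j = 0 := by
  by_contra hne
  have hU : {x : Fin n → ℝ | coord x j ≠ 0} ∈ 𝓝 (pt z) := by
    refine (isOpen_ne_fun (continuous_coord j) continuous_const).mem_nhds ?_
    rw [mem_ofPred_eq, coord_pt hz]
    exact mul_ne_zero (inv_ne_zero hz.2.1.ne') hne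
  obtain ⟨t, ht⟩ := exists_cell_subset hc' hu hza hU
  obtain ⟨u, hu', h1⟩ := hya t
  obtain ⟨r, hr, h2⟩ := exists_pos_smul_of_pt_eq hy (word_mulVec_mem_cone hc _ hu') h1.symm
  have h3 : ∑ i, word n c (initialWord a t) j i * u i = 0 := by
    have := congrFun h2 j
    rw [hj, Pi.smul_apply, smul_eq_mul] at this
    exact (mul_eq_zero.1 this.symm).resolve_left hr.ne'
  obtain ⟨i, -, hi⟩ := Finset.exists_ne_zero_of_sum_ne_zero hu'.2.1.ne'
  have h4 := (Finset.sum_eq_zero_iff_of_nonneg fun i _ =>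
    mul_nonneg (word_nonneg hc.le _ j i) (hu'.1 i)).1 h3 i (Finset.mem_univ i)
  have h5 := (word_eq_zero_iff hc hc' _ j i).1 ((mul_eq_zero.1 h4).resolve_right hi)
  refine ht (vertex_mem_cell c' (initialWord a t) i) ?_
  have h6 := word_mulVec_mem_cone hc' (initialWord a t) (single_mem_cone (n := n) i)
  rw [mulVec_single_one] at h6
  rw [vertex, colPoint_eq_pt, coord_pt h6]
  simp [h5]

/-- On each cell `Φ` respects the faces: by self-similarity this reduces to the faces of `Δ`, where the
coordinates that vanish are the same before and after `Φ`. -/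
theorem Phi_image_face [NeZero n] (w : List Bool) (S : Set (Fin (n + 1))) :
    Phi n '' ((fun y => pt (word n 1 w *ᵥ y)) '' cone n S) =
      (fun y => pt (word n (1 / 2) w *ᵥ y)) '' cone n S := by
  have hhalf : (0 : ℝ) < 1 / 2 := by norm_num
  apply Subset.antisymm
  · rintro _ ⟨_, ⟨y, hy, rfl⟩, rfl⟩
    have hy' := cone_subset_univ S hy
    obtain ⟨a, ha⟩ := exists_isLimit_of_mem_Delta one_pos (mem_Delta_iff.2 ⟨y, hy', rfl⟩)
    obtain ⟨q, hq⟩ := exists_isLimit (n := n) hhalf a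
    obtain ⟨z, hz, rfl⟩ := mem_Delta_iff.1 (hq.mem_Delta hhalf)
    exact ⟨z, ⟨hz.1, hz.2.1, fun j hj => ha.coord_eq_zero one_pos hhalf limitsUnique_half hy' hz hq
      (hy.2.2 j hj)⟩, (Phi_pt_word w hy' hz ha hq).symm⟩
  · rintro _ ⟨z, hz, rfl⟩
    have hz' := cone_subset_univ S hz
    obtain ⟨a, ha⟩ := exists_isLimit_of_mem_Delta hhalf (mem_Delta_iff.2 ⟨z, hz', rfl⟩)
    obtain ⟨q, hq⟩ := exists_isLimit (n := n) one_pos a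
    obtain ⟨y, hy, rfl⟩ := mem_Delta_iff.1 (hq.mem_Delta one_pos)
    exact ⟨_, ⟨y, ⟨hy.1, hy.2.1, fun j hj => ha.coord_eq_zero hhalf one_pos limitsUnique_one hz' hy
      hq (hz.2.2 j hj)⟩, rfl⟩, Phi_pt_word w hy hz' hq ha⟩

/-! ### Faces -/

theorem convexHull_vertex [NeZero n] {c : ℝ} (hc : 0 < c) (w : List Bool)
    (S : Set (Fin (n + 1))) : convexHull ℝ (vertex n c w '' S) =
      (fun y => pt (word n c w *ᵥ y)) '' cone n S :=
  convexHull_colPoint (colSum_word_pos hc w) S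

theorem convexHull_vertex_subset_Delta [NeZero n] {c : ℝ} (hc : 0 < c) (w : List Bool)
    (S : Set (Fin (n + 1))) : convexHull ℝ (vertex n c w '' S) ⊆ Delta n := by
  refine Subset.trans ?_ (cell_subset_Delta hc w)
  rw [cell_eq_convexHull hc]
  exact convexHull_mono (image_subset_range _ _)

theorem extremePoints_cell [NeZero n] {c : ℝ} (hc : 0 < c) (w : List Bool) :
    (cell n c w).extremePoints ℝ = range (vertex n c w) := by
  rw [cell_eq_convexHull hc]
  apply Subset.antisymm extremePoints_convexHull_subset
  rintro _ ⟨i, rfl⟩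
  exact colPoint_mem_extremePoints (colSum_word_pos hc w) (word_mulVec_injective hc w) i

theorem exists_subset_extremePoints_iff [NeZero n] {c : ℝ} (hc : 0 < c) (w : List Bool)
    {σ : Set (Fin n → ℝ)} : (∃ s ⊆ (cell n c w).extremePoints ℝ, σ = convexHull ℝ s) ↔
      ∃ S, σ = convexHull ℝ (vertex n c w '' S) := by
  rw [extremePoints_cell hc]
  constructor
  · rintro ⟨s, hs, rfl⟩
    obtain ⟨S, rfl⟩ := subset_range_iff_exists_image_eq.1 hs
    exact ⟨S, rfl⟩
  · rintro ⟨S, rfl⟩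
    exact ⟨_, image_subset_range _ _, rfl⟩

theorem mem_fareyComplex_iff [NeZero n] {t : ℕ} {σ : Set (Fin n → ℝ)} : σ ∈ fareyComplex n t ↔
    ∃ w : List Bool, w.length = t ∧ ∃ S, σ = convexHull ℝ (vertex n 1 w '' S) := by
  simp only [fareyComplex, mem_ofPred_eq, fareyCell_eq_cell,
    exists_subset_extremePoints_iff one_pos]

theorem mem_baryComplex_iff [NeZero n] {t : ℕ} {σ : Set (Fin n → ℝ)} : σ ∈ baryComplex n t ↔
    ∃ w : List Bool, w.length = t ∧ ∃ S, σ = convexHull ℝ (vertex n (1 / 2) w '' S) := by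
  simp only [baryComplex, mem_ofPred_eq, baryCell_eq_cell,
    exists_subset_extremePoints_iff (show (0 : ℝ) < 1 / 2 by norm_num)]

theorem fareyVertex_eq_vertex (w : List Bool) : fareyVertex n w = vertex n 1 w := rfl

theorem baryVertex_eq_vertex (w : List Bool) : baryVertex n w = vertex n (1 / 2) w := rfl

/-- Every vertex of `Δ` is a vertex of the subdivisions, with an index that does not depend on the
parameter. -/
theorem exists_vertex_eq [NeZero n] (t : ℕ) (j : Fin (n + 1)) :
    ∃ w : List Bool, w.length = t ∧ ∃ i, ∀ c, vertex n c w i = colPoint (V n) j := by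
  have h1 := val_one_fin (n := n)
  have hstep (i : Fin (n + 1)) : ∃ a i', ∀ c, (stepMatrix n c a).col i' = Pi.single i 1 := by
    have hsingle (k : Fin (n + 1)) :
        (Pi.single i 1 : Fin (n + 1) → ℝ) k = if (k : ℕ) = i then 1 else 0 := by
      simp only [Pi.single_apply, Fin.ext_iff]
    by_cases hi : (i : ℕ) ≤ 1
    · refine ⟨decide ((i : ℕ) = 1), 0, fun c => funext fun k => ?_⟩
      rw [hsingle]
      simp only [col_apply, stepMatrix, of_apply, Fin.val_zero, if_true, decide_eq_true_eq]
      congr 2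
      split_ifs <;> omega
    · refine ⟨false, ⟨i - 1, by omega⟩, fun c => funext fun k => ?_⟩
      rw [hsingle]
      simp only [col_apply, stepMatrix, of_apply]
      rw [if_neg (by omega), if_neg (by omega), show (i : ℕ) - 1 + 1 = i by omega]
  suffices h : ∃ w : List Bool, w.length = t ∧ ∃ i, ∀ c, (word n c w).col i = Pi.single j 1 by
    obtain ⟨w, hw, i, hi⟩ := h
    refine ⟨w, hw, i, fun c => ?_⟩
    rw [vertex, colPoint_eq_pt, hi, pt, mulVec_single_one]
    rfl
  induction t with
  | zero => exact ⟨[], rfl, j, fun c => funext fun k => by simp [one_apply, Pi.single_apply]⟩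
  | succ t ih =>
    obtain ⟨w, hw, i, hi⟩ := ih
    obtain ⟨a, i', h⟩ := hstep i
    refine ⟨w ++ [a], by simp [hw], i', fun c => ?_⟩
    have h2 : (word n c (w ++ [a])).col i' = word n c w *ᵥ (stepMatrix n c a).col i' := by
      rw [word_append, word_singleton]
      rfl
    rw [h2, h, mulVec_single_one, hi]

/-! ### The simplicial approximations -/

theorem mem_cell_iff [NeZero n] {c : ℝ} (hc : 0 < c) {w : List Bool} {x : Fin n → ℝ} :
    x ∈ cell n c w ↔ ∃ α ∈ stdSimplex ℝ (Fin (n + 1)), ∑ i, α i • vertex n c w i = x := by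
  rw [cell_eq_convexHull hc, ← image_univ, convexHull_image_eq]
  simp

/-- A point with barycentric coordinates with respect to two simplexes of the subdivision of depth
`t` for the parameter `c` yields the same point in the subdivision for `c'`. -/
theorem sum_smul_vertex_transfer [NeZero n] {c c' : ℝ} (hc : 0 < c) (hc' : 0 < c')
    {w w' : List Bool} (hw : w.length = w'.length) {α β : Fin (n + 1) → ℝ}
    (hα : α ∈ stdSimplex ℝ (Fin (n + 1))) (hβ : β ∈ stdSimplex ℝ (Fin (n + 1)))
    (h : ∑ i, α i • vertex n c w i = ∑ i, β i • vertex n c w' i) :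
    ∑ i, α i • vertex n c' w i = ∑ i, β i • vertex n c' w' i := by
  have h1 := mulVec_div_colSum_eq (colSum_word_pos hc w) (colSum_word_pos hc w') hα.2 hβ.2 h
  have h2 := sum_smul_eq_of_word_mulVec_eq hc hc' w w' hw _ _
    (fun i => div_nonneg (hα.1 i) (colSum_word_pos hc w i).le)
    (fun i => div_nonneg (hβ.1 i) (colSum_word_pos hc w' i).le) h1
    fun u v => (∑ i, u i) • pt v
  have h3 (u : List Bool) (γ : Fin (n + 1) → ℝ) :
      ∑ i, (γ i / colSum (word n c u) i) • (∑ k, (word n c u).col i k) • pt ((word n c' u).col i) =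
        ∑ i, γ i • vertex n c' u i := by
    refine Finset.sum_congr rfl fun i _ => ?_
    have h4 : ∑ k, (word n c u).col i k = colSum (word n c u) i := rfl
    rw [h4, smul_smul, div_mul_cancel₀ _ (colSum_word_pos hc u i).ne']
    rfl
  rwa [h3, h3] at h2

/-- The map that is affine on each simplex of the subdivision of depth `t` for the parameter `c`,
and takes its vertices to those of the corresponding simplex for `c'`. -/
noncomputable def simplicialMap (n : ℕ) (c c' : ℝ) (t : ℕ) (x : Fin n → ℝ) : Fin n → ℝ :=
  Classical.epsilon fun z => ∃ w : List Bool, w.length = t ∧ ∃ α ∈ stdSimplex ℝ (Fin (n + 1)),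
    ∑ i, α i • vertex n c w i = x ∧ ∑ i, α i • vertex n c' w i = z

theorem simplicialMap_sum [NeZero n] {c c' : ℝ} (hc : 0 < c) (hc' : 0 < c') (w : List Bool)
    {α : Fin (n + 1) → ℝ} (hα : α ∈ stdSimplex ℝ (Fin (n + 1))) :
    simplicialMap n c c' w.length (∑ i, α i • vertex n c w i) =
      ∑ i, α i • vertex n c' w i := by
  obtain ⟨w', hw', β, hβ, h1, h2⟩ := Classical.epsilon_spec
    (p := fun z => ∃ w' : List Bool, w'.length = w.length ∧ ∃ β ∈ stdSimplex ℝ (Fin (n + 1)),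
      ∑ i, β i • vertex n c w' i = ∑ i, α i • vertex n c w i ∧ ∑ i, β i • vertex n c' w' i = z)
    ⟨_, w, rfl, α, hα, rfl, rfl⟩
  exact h2.symm.trans (sum_smul_vertex_transfer hc hc' hw' hβ hα h1)

theorem exists_word_of_mem_Delta [NeZero n] {c : ℝ} (hc : 0 < c) (t : ℕ) {x : Fin n → ℝ}
    (hx : x ∈ Delta n) : ∃ w : List Bool, w.length = t ∧
      ∃ α ∈ stdSimplex ℝ (Fin (n + 1)), ∑ i, α i • vertex n c w i = x := by
  obtain ⟨a, ha⟩ := exists_isLimit_of_mem_Delta hc hx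
  exact ⟨initialWord a t, by simp, (mem_cell_iff hc).1 (ha t)⟩

theorem injOn_simplicialMap [NeZero n] {c c' : ℝ} (hc : 0 < c) (hc' : 0 < c') (t : ℕ) :
    InjOn (simplicialMap n c c' t) (Delta n) := by
  intro x hx y hy h
  obtain ⟨w, hw, α, hα, rfl⟩ := exists_word_of_mem_Delta hc t hx
  obtain ⟨w', hw', β, hβ, rfl⟩ := exists_word_of_mem_Delta hc t hy
  subst hw
  have h1 := simplicialMap_sum hc hc' w' hβ
  rw [hw'] at h1
  rw [simplicialMap_sum hc hc' w hα, h1] at h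
  exact sum_smul_vertex_transfer hc' hc hw'.symm hα hβ h

theorem simplicialMap_image_face [NeZero n] {c c' : ℝ} (hc : 0 < c) (hc' : 0 < c') (w : List Bool)
    (S : Set (Fin (n + 1))) : simplicialMap n c c' w.length '' convexHull ℝ (vertex n c w '' S) =
      convexHull ℝ (vertex n c' w '' S) := by
  rw [convexHull_image_eq, convexHull_image_eq]
  ext x
  constructor
  · rintro ⟨_, ⟨α, hα, hS, rfl⟩, rfl⟩
    exact ⟨α, hα, hS, (simplicialMap_sum hc hc' w hα).symm⟩
  · rintro ⟨α, hα, hS, rfl⟩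
    exact ⟨_, ⟨α, hα, hS, rfl⟩, simplicialMap_sum hc hc' w hα⟩

theorem isCompact_Delta [NeZero n] : IsCompact (Delta n) := by
  rw [Delta_eq_cell one_pos]
  exact isCompact_cell one_pos []

theorem restrictsToHomeo_simplicialMap [NeZero n] {c c' : ℝ} (hc : 0 < c) (hc' : 0 < c') (t : ℕ) :
    RestrictsToHomeo (simplicialMap n c c' t) (Delta n) (Delta n) := by
  -- The disjoint union of the closed simplexes maps onto `Δ` for both parameters.
  let p (e : ℝ) (x : (Fin t → Bool) × stdSimplex ℝ (Fin (n + 1))) : Fin n → ℝ :=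
    ∑ i, x.2 i • vertex n e (List.ofFn x.1) i
  have hp (e : ℝ) : Continuous (p e) := by
    rw [continuous_prod_of_discrete_left]
    intro g
    change Continuous fun x : stdSimplex ℝ (Fin (n + 1)) =>
      ∑ i, x i • vertex n e (List.ofFn g) i
    exact continuous_finsetSum _ fun i _ =>
      ((continuous_apply i).comp continuous_subtype_val).smul continuous_const
  have hrange {e : ℝ} (he : 0 < e) : range (p e) = Delta n := by
    apply Subset.antisymm
    · rintro _ ⟨x, rfl⟩
      exact cell_subset_Delta he _ ((mem_cell_iff he).2 ⟨x.2, x.2.2, rfl⟩)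
    · intro x hx
      obtain ⟨w, rfl, α, hα, rfl⟩ := exists_word_of_mem_Delta he t hx
      exact ⟨(w.get, ⟨α, hα⟩), by simp only [p, List.ofFn_get]; rfl⟩
  have hcomp : simplicialMap n c c' t ∘ p c = p c' := by
    funext x
    have := simplicialMap_sum hc hc' (List.ofFn x.1) x.2.2
    rw [List.length_ofFn] at this
    exact this
  refine restrictsToHomeo_of_isCompact isCompact_Delta ?_ (injOn_simplicialMap hc hc' t) ?_
  · rw [← hrange hc]
    exact continuousOn_range_of_comp (hp c) (hcomp ▸ hp c')
  · conv_lhs => rw [← hrange hc]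
    rw [← range_comp, hcomp, hrange hc']

theorem tendstoUniformlyOn_simplicialMap [NeZero n] :
    TendstoUniformlyOn (simplicialMap n 1 (1 / 2)) (Phi n) atTop (Delta n) := by
  have hhalf : (0 : ℝ) < 1 / 2 := by norm_num
  rw [Metric.tendstoUniformlyOn_iff]
  intro ε hε
  have h1 : Tendsto (fun k : ℕ => contractionFactor n ^ k * Metric.diam (Delta n)) atTop
      (𝓝 (0 * Metric.diam (Delta n))) :=
    (tendsto_pow_atTop_nhds_zero_of_lt_one contractionFactor_nonneg
      contractionFactor_lt_one).mul_const _
  rw [zero_mul] at h1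
  obtain ⟨k, hk⟩ := (h1.eventually_lt_const hε).exists
  filter_upwards [eventually_ge_atTop (k * scramblingTime n)] with t ht x hx
  rw [← range_phi] at hx
  obtain ⟨a, rfl⟩ := hx
  obtain ⟨α, hα, h2⟩ := (mem_cell_iff one_pos).1 (isLimit_phi (n := n) a t)
  have h3 := simplicialMap_sum one_pos hhalf (initialWord a t) hα
  rw [length_initialWord, h2] at h3
  rw [Phi_phi, h3]
  refine lt_of_le_of_lt (Metric.dist_le_diam_of_mem
    (isCompact_cell hhalf (initialWord a t)).isBounded (isLimit_upsilon a t)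
    ((mem_cell_iff hhalf).2 ⟨α, hα, rfl⟩)) ?_
  exact (diam_baryCell_le k _ (by simpa using ht)).trans_lt hk

/-! ### The combinatorial isomorphism -/

/-- The isomorphism takes a face to its image under the simplicial map. -/
theorem exists_isCombIso [NeZero n] (t : ℕ) :
    ∃ e : fareyComplex n t ≃o baryComplex n t, IsCombIso n t e := by
  have hhalf : (0 : ℝ) < 1 / 2 := by norm_num
  have hinj := injOn_simplicialMap (n := n) one_pos hhalf t
  have hsub (σ : fareyComplex n t) : (σ : Set (Fin n → ℝ)) ⊆ Delta n := by
    obtain ⟨w, -, S, h⟩ := mem_fareyComplex_iff.1 σ.2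
    rw [h]
    exact convexHull_vertex_subset_Delta one_pos w S
  let f : fareyComplex n t → baryComplex n t := fun σ =>
    ⟨simplicialMap n 1 (1 / 2) t '' σ, by
      obtain ⟨w, rfl, S, h⟩ := mem_fareyComplex_iff.1 σ.2
      rw [h, simplicialMap_image_face one_pos hhalf]
      exact mem_baryComplex_iff.2 ⟨w, rfl, S, rfl⟩⟩
  have hf : Function.Bijective f := by
    constructor
    · intro σ τ h
      exact Subtype.ext ((hinj.image_eq_image_iff (hsub σ) (hsub τ)).1 (congrArg Subtype.val h))
    · rintro ⟨τ, hτ⟩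
      obtain ⟨w, rfl, S, rfl⟩ := mem_baryComplex_iff.1 hτ
      exact ⟨⟨_, mem_fareyComplex_iff.2 ⟨w, rfl, S, rfl⟩⟩,
        Subtype.ext (simplicialMap_image_face one_pos hhalf w S)⟩
  have hface (w : List Bool) (hw : w.length = t) (S : Set (Fin (n + 1))) :
      ∃ h : convexHull ℝ (vertex n 1 w '' S) ∈ fareyComplex n t,
        (f ⟨convexHull ℝ (vertex n 1 w '' S), h⟩ : Set (Fin n → ℝ)) =
          convexHull ℝ (vertex n (1 / 2) w '' S) := by
    subst hw
    exact ⟨mem_fareyComplex_iff.2 ⟨w, rfl, S, rfl⟩, simplicialMap_image_face one_pos hhalf w S⟩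
  refine ⟨⟨Equiv.ofBijective f hf, fun {σ τ} => hinj.image_subset_image_iff (hsub σ) (hsub τ)⟩,
    fun j => ?_, fun w hw => ?_, fun w hw S => hface w hw S⟩
  · obtain ⟨w, hw, i, hi⟩ := exists_vertex_eq t j
    have h := hface w hw {i}
    simp only [image_singleton, convexHull_singleton, hi] at h
    exact h
  · have h := hface w hw univ
    simp only [image_univ, ← cell_eq_convexHull one_pos, ← cell_eq_convexHull hhalf,
      ← fareyCell_eq_cell, ← baryCell_eq_cell] at h
    exact h

theorem IsCombIso.unique [NeZero n] {t : ℕ} {e e' : fareyComplex n t ≃o baryComplex n t}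
    (h : IsCombIso n t e) (h' : IsCombIso n t e') : e = e' := by
  refine DFunLike.ext _ _ ?_
  rintro ⟨σ, hσ⟩
  obtain ⟨w, hw, S, rfl⟩ := mem_fareyComplex_iff.1 hσ
  exact Subtype.ext ((h.2.2 w hw S).2.trans (h'.2.2 w hw S).2.symm)

theorem IsCombIso.restrictsToHomeo_Phi [NeZero n] {t : ℕ}
    {e : fareyComplex n t ≃o baryComplex n t} (h : IsCombIso n t e) (σ : fareyComplex n t) :
    RestrictsToHomeo (Phi n) σ (e σ) := by
  obtain ⟨σ, hσ⟩ := σ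
  obtain ⟨w, hw, S, rfl⟩ := mem_fareyComplex_iff.1 hσ
  have h1 := (h.2.2 w hw S).2
  simp only [fareyVertex_eq_vertex, baryVertex_eq_vertex] at h1
  have hsub := convexHull_vertex_subset_Delta one_pos w S
  rw [h1]
  refine restrictsToHomeo_of_isCompact ?_ (continuousOn_Phi.mono hsub) (injOn_Phi.mono hsub) ?_
  · exact (toFinite _).isCompact_convexHull ℝ
  · change Phi n '' convexHull ℝ (vertex n 1 w '' S) = _
    rw [convexHull_vertex one_pos, convexHull_vertex (by norm_num), Phi_image_face]

end Monkemeyer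

theorem mainTheorem5 (n : ℕ) (hn : 1 ≤ n) :
    -- `Φ` is well defined on `Δ` by `Φ(φ(a)) = υ(a)`
    ((∀ a : ℕ → Bool,
        (⋂ t, Monkemeyer.fareyCell n (Monkemeyer.initialWord a t)) = {Monkemeyer.phi n a} ∧
        (⋂ t, Monkemeyer.baryCell n (Monkemeyer.initialWord a t)) = {Monkemeyer.upsilon n a} ∧
        Monkemeyer.Phi n (Monkemeyer.phi n a) = Monkemeyer.upsilon n a) ∧
      Set.range (Monkemeyer.phi n) = Monkemeyer.Delta n) ∧
    -- `Φ` maps each simplex of `𝓕_t` homeomorphically onto the corresponding simplex of `𝓑_t`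
    (∀ t : ℕ,
      (∃! e : Monkemeyer.fareyComplex n t ≃o Monkemeyer.baryComplex n t,
        Monkemeyer.IsCombIso n t e) ∧
      ∀ e : Monkemeyer.fareyComplex n t ≃o Monkemeyer.baryComplex n t,
        Monkemeyer.IsCombIso n t e →
        ∀ Ξ : Monkemeyer.fareyComplex n t,
          Monkemeyer.RestrictsToHomeo (Monkemeyer.Phi n) Ξ (e Ξ)) ∧
    -- self-similarity
    (∀ w : List Bool,
      Monkemeyer.RestrictsToHomeo (Monkemeyer.Mword n w)
        (Monkemeyer.fareyCell n w) (Monkemeyer.Delta n) ∧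
      ∀ x ∈ Monkemeyer.Delta n,
        Monkemeyer.Phi n x =
          Monkemeyer.Tword n w (Monkemeyer.Phi n
            (Function.invFunOn (Monkemeyer.Mword n w) (Monkemeyer.fareyCell n w) x))) ∧
    -- `Φ` is the uniform limit of the simplicial homeomorphisms `Φ_t`
    (∃ Φt : ℕ → (Fin n → ℝ) → (Fin n → ℝ),
      (∀ t, Monkemeyer.IsSimplicialExtension n t (Φt t) ∧
        Monkemeyer.RestrictsToHomeo (Φt t) (Monkemeyer.Delta n) (Monkemeyer.Delta n)) ∧
      TendstoUniformlyOn Φt (Monkemeyer.Phi n) Filter.atTop (Monkemeyer.Delta n)) := by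
  have : NeZero n := ⟨by omega⟩
  refine ⟨⟨fun a => ⟨?_, ?_, Monkemeyer.Phi_phi a⟩, Monkemeyer.range_phi⟩, fun t => ⟨?_, ?_⟩,
    fun w => ⟨Monkemeyer.restrictsToHomeo_Mword w, fun x hx => Monkemeyer.Phi_eq_Tword_Phi w hx⟩,
    Monkemeyer.simplicialMap n 1 (1 / 2), fun t => ⟨?_, ?_⟩,
    Monkemeyer.tendstoUniformlyOn_simplicialMap⟩
  · simp only [Monkemeyer.fareyCell_eq_cell]
    exact Monkemeyer.iInter_cell_eq_singleton Monkemeyer.limitsUnique_one (Monkemeyer.isLimit_phi a)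
  · simp only [Monkemeyer.baryCell_eq_cell]
    exact Monkemeyer.iInter_cell_eq_singleton Monkemeyer.limitsUnique_half
      (Monkemeyer.isLimit_upsilon a)
  · obtain ⟨e, he⟩ := Monkemeyer.exists_isCombIso (n := n) t
    exact ⟨e, he, fun e' he' => he'.unique he⟩
  · exact fun e he Ξ => he.restrictsToHomeo_Phi Ξ
  · rintro w rfl α hα
    exact Monkemeyer.simplicialMap_sum one_pos (by norm_num) w hα
  · exact Monkemeyer.restrictsToHomeo_simplicialMap one_pos (by norm_num) t
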